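/- Let $G$ be a finite simple graph on $n$ vertices. Some vertices are colored blue and the others white. The skew color change rule is: if any vertex (blue or white) has exactly one white neighbor, then this neighbor becomes blue. A set $Z\subseteq V(G)$ is a skew zero forcing set if, starting with exactly the vertices of $Z$ blue, repeated application of the rule turns all vertices blue. Let $\lambda^-(G)$ be the number of integers $k$ for which there exist $Z,F\subseteq V(G)$ with $|Z|=|F|=k$ such that $Z$ is a skew zero forcing set and $F$ is not. Then $\lambda^-(G)=0$ if and only if $G$ is one of the following graphs. 1. The complete graph $K_n$. 2. The edgeless graph $\overline{K_n}$. 3. A doubly extended bouquet-dipole: for some $m\ge 0$ there are distinct vertices $u=s_0,s_1,\dots,s_{2m+1}=v$ such that $G$ consists of a nonempty set of odd cycles through $u$, a nonempty set of odd cycles through $v$ and, for each $0\le j\le 2m$, paths of even order (number of vertices) from $s_j$ to $s_{j+1}$, namely exactly one such path if $j$ is even and two or more if $j$ is odd. Here every vertex on these cycles and paths, other than $u$, respectively $v$, on its cycles and the two ends of each path, is different from all the $s_i$ and has degree two in $G$. 4. A collection of one or more odd cycles that share one vertex, any two of them having exactly this vertex in common. 5. A two-set perfectly orderable graph: $V(G)$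 can be partitioned into ordered sets $U=\{u_1,\dots,u_m\}$ and $W=\{w_1,\dots,w_m\}$ such that every neighbor of $u_i$ is some $w_j$ with $j\le i$, and $u_iw_i\in E(G)$ for all $i\in\{1,\dots,m\}$. -/

import Mathlib

/-- One application of the skew color change rule, `B` and `B'` being the sets of blue vertices
before and after: some vertex `u`, blue or white, has exactly one white neighbor `w`, and `w`
becomes blue. -/
def SkewColorChange {V : Type*} [DecidableEq V] (G : SimpleGraph V) (B B' : Finset V) : Prop :=
  ∃ u w : V, {x : V | G.Adj u x ∧ x ∉ B} = {w} ∧ B' = insert w B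

/-- `Z` is a skew zero forcing set: finitely many (possibly zero) applications of the skew color
change rule turn every vertex blue. -/
def IsSkewZeroForcing {V : Type*} [Fintype V] [DecidableEq V] (G : SimpleGraph V)
    (Z : Finset V) : Prop :=
  Relation.ReflTransGen (SkewColorChange G) Z Finset.univ

/-- The skew zero forcing span: the number of cardinalities `k` for which some `k`-set of vertices
is a skew zero forcing set and some `k`-set is not. -/
noncomputable def skewZeroForcingSpan {V : Type*} [Fintype V] [DecidableEq V]
    (G : SimpleGraph V) : ℕ :=
  Set.ncard {k : ℕ | ∃ Z F : Finset V, Z.card = k ∧ F.card = k ∧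
    IsSkewZeroForcing G Z ∧ ¬ IsSkewZeroForcing G F}

/-- `V` is partitioned into `u₁, …, uₘ` and `w₁, …, wₘ` such that every neighbor of `uᵢ` is some
`wⱼ` with `j ≤ i`, and `uᵢ` is adjacent to `wᵢ` for all `i`. -/
def IsTwoSetPerfectlyOrderable {V : Type*} (G : SimpleGraph V) : Prop :=
  ∃ (m : ℕ) (u w : Fin m → V),
    Function.Injective u ∧ Function.Injective w ∧
    Disjoint (Set.range u) (Set.range w) ∧ Set.range u ∪ Set.range w = Set.univ ∧
    (∀ (i : Fin m) (x : V), G.Adj (u i) x → ∃ j : Fin m, j ≤ i ∧ x = w j) ∧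
    ∀ i : Fin m, G.Adj (u i) (w i)

/-- `G` is the union of a nonempty collection `C` of odd cycles through a vertex `c`, any two of
which have exactly the vertex `c` in common. -/
def IsOddCycleBouquet {V : Type*} (G : SimpleGraph V) : Prop :=
  ∃ (c : V) (C : Set (G.Walk c c)),
    C.Nonempty ∧
    (∀ p ∈ C, p.IsCycle ∧ Odd p.length) ∧
    (∀ p ∈ C, ∀ q ∈ C, p ≠ q → {x | x ∈ p.support ∧ x ∈ q.support} = {c}) ∧
    (∀ x : V, ∃ p ∈ C, x ∈ p.support) ∧
    ∀ e ∈ G.edgeSet, ∃ p ∈ C, e ∈ p.edges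

/-- Distinct vertices `s 0, s 1, …, s (2m+1)` are given, with `u = s 0` and `v = s (2m+1)`.
The set `C` is a nonempty collection of odd cycles through `u`, and `D` is one through `v`.
For each `j ≤ 2m` the set `P j` consists of paths of even order (that is, odd length) from `s j`
to `s (j+1)`: of a single path if `j` is even, of at least two paths if `j` is odd.
Apart from the vertices named as base point or ends, all vertices on these cycles and paths are
different from all the `s j` and have degree two in `G`. The graph consists of these cycles and
paths. -/
def IsDoublyExtendedBouquetDipole {V : Type*} (G : SimpleGraph V) : Prop :=
  ∃ (m : ℕ) (s : Fin (2 * m + 1 + 1) → V)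
    (C : Set (G.Walk (s 0) (s 0)))
    (D : Set (G.Walk (s (Fin.last (2 * m + 1))) (s (Fin.last (2 * m + 1)))))
    (P : ∀ j : Fin (2 * m + 1), Set (G.Walk (s j.castSucc) (s j.succ))),
    Function.Injective s ∧
    C.Nonempty ∧ D.Nonempty ∧
    (∀ c ∈ C, c.IsCycle ∧ Odd c.length ∧ ∀ x ∈ c.support, x ≠ s 0 →
      x ∉ Set.range s ∧ (G.neighborSet x).ncard = 2) ∧
    (∀ d ∈ D, d.IsCycle ∧ Odd d.length ∧ ∀ x ∈ d.support, x ≠ s (Fin.last (2 * m + 1)) →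
      x ∉ Set.range s ∧ (G.neighborSet x).ncard = 2) ∧
    (∀ j, ∀ p ∈ P j, p.IsPath ∧ Odd p.length ∧
      ∀ x ∈ p.support, x ≠ s j.castSucc → x ≠ s j.succ →
        x ∉ Set.range s ∧ (G.neighborSet x).ncard = 2) ∧
    (∀ j : Fin (2 * m + 1), Even (j : ℕ) → ∃ p, P j = {p}) ∧
    (∀ j : Fin (2 * m + 1), Odd (j : ℕ) → (P j).Nontrivial) ∧
    (∀ x : V, (∃ c ∈ C, x ∈ c.support) ∨ (∃ d ∈ D, x ∈ d.support) ∨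
      ∃ j, ∃ p ∈ P j, x ∈ p.support) ∧
    ∀ e ∈ G.edgeSet, (∃ c ∈ C, e ∈ c.edges) ∨ (∃ d ∈ D, e ∈ d.edges) ∨
      ∃ j, ∃ p ∈ P j, e ∈ p.edges

/-!
A set fails to be skew zero forcing if and only if its complement contains a skew fort: a nonempty
set of vertices in which no vertex of the graph has exactly one neighbor. Hence the span vanishes
if and only if there are no skew forts at all, which characterizes the two-set perfectly orderable
graphs, or, for some `f`, every `f`-set is a skew fort and no smaller set is one.

For `f = 1` the graph has no edges. For `2 ≤ f < n` put `t = n + 2 - f`: any `t - 1` vertices have a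
common neighbor of degree `t`, and counting these neighborhoods forces the graph to be complete.

For `f = n` the only skew fort is the set of all vertices. Let `H` be the set of vertices of degree
other than two, and call two vertices linked if they are neighbors of a common vertex of degree two.
By rank-nullity there are at least as many classes of linked vertices as elements of `H`. If there
is only one class, then the graph is a bouquet of odd cycles. Otherwise for each class some vertex
has exactly one neighbor outside it, as its complement is not a skew fort, and this matches the
classes with the elements of `H`: all neighbors of an `h` in `H` but one are in the class of `h`.
All paths through degree-two vertices between vertices of `H` are therefore of odd length, and `H`
carries two involutions, one along the bundles of at least two paths and one, without fixed points,
along the single paths. Their product acts transitively, and following them alternately enumerates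
`H` as `s 0, …, s (2 * m + 1)`.
-/

/-- A skew fort: a nonempty set in which no vertex of the graph has exactly one neighbor. If the
vertices of a skew fort are all white, then they stay white under the skew color change rule. -/
def IsSkewFort {V : Type*} (G : SimpleGraph V) (F : Set V) : Prop :=
  F.Nonempty ∧ ∀ u, ¬ ∃! w, w ∈ F ∧ G.Adj u w

theorem IsSkewFort.exists_ne_adj {V : Type*} {G : SimpleGraph V} {F : Set V}
    (hF : IsSkewFort G F) {u w : V} (hw : w ∈ F) (huw : G.Adj u w) :
    ∃ w' ∈ F, w' ≠ w ∧ G.Adj u w' := by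
  by_contra! h
  exact hF.2 u ⟨w, ⟨hw, huw⟩, fun w' ⟨hw', huw'⟩ => by_contra fun hne => h w' hw' hne huw'⟩

theorem exists_existsUnique_of_not_isSkewFort {V : Type*} {G : SimpleGraph V} {F : Set V}
    (hF : ¬ IsSkewFort G F) (hne : F.Nonempty) : ∃ u, ∃! w, w ∈ F ∧ G.Adj u w := by
  by_contra! h
  exact hF ⟨hne, h⟩

theorem IsSkewFort.preimage_equiv {V W : Type*} {G : SimpleGraph W} {F : Set W}
    (hF : IsSkewFort G F) (e : V ≃ W) : IsSkewFort (G.comap e) (e ⁻¹' F) := by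
  refine ⟨hF.1.preimage e.surjective, fun u ⟨w, ⟨hw, huw⟩, huniq⟩ => hF.2 (e u) ?_⟩
  refine ⟨e w, ⟨hw, huw⟩, fun y ⟨hy, huy⟩ => ?_⟩
  rw [← huniq (e.symm y) (by simpa using ⟨hy, huy⟩), e.apply_symm_apply]

theorem SkewColorChange.disjoint {V : Type*} [DecidableEq V] {G : SimpleGraph V}
    {B B' : Finset V} {F : Set V} (h : SkewColorChange G B B') (hF : IsSkewFort G F)
    (hB : Disjoint (B : Set V) F) : Disjoint (B' : Set V) F := by
  obtain ⟨u, w, huw, rfl⟩ := h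
  rw [Finset.coe_insert, Set.disjoint_insert_left]
  refine ⟨fun hw => ?_, hB⟩
  obtain ⟨w', hw', hne, huw'⟩ := hF.exists_ne_adj hw (huw.ge rfl).1
  exact hne (huw.le ⟨huw', fun hB' => Set.disjoint_left.1 hB hB' hw'⟩)

section Forcing

variable {V : Type*} [Fintype V] [DecidableEq V] {G : SimpleGraph V}

theorem IsSkewZeroForcing.not_disjoint {Z : Finset V} (hZ : IsSkewZeroForcing G Z) {F : Set V}
    (hF : IsSkewFort G F) : ¬ Disjoint (Z : Set V) F := by
  intro hdisj
  have hreach (B : Finset V) (hB : Relation.ReflTransGen (SkewColorChange G) Z B) :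
      Disjoint (B : Set V) F := by
    induction hB with
    | refl => exact hdisj
    | tail _ hstep ih => exact hstep.disjoint hF ih
  exact hF.1.ne_empty (Set.univ_disjoint.1 (by simpa using hreach _ hZ))

theorem exists_skewColorChange {Z : Finset V} (hZ : Z ≠ Finset.univ)
    (hF : ¬ IsSkewFort G (Z : Set V)ᶜ) : ∃ w ∉ Z, SkewColorChange G Z (insert w Z) := by
  have hne : ((Z : Set V)ᶜ).Nonempty := by
    rwa [Set.nonempty_compl, ne_eq, Finset.coe_eq_univ]
  obtain ⟨u, w, ⟨hw, huw⟩, huniq⟩ := exists_existsUnique_of_not_isSkewFort hF hne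
  refine ⟨w, hw, u, w, ?_, rfl⟩
  ext x
  exact ⟨fun hx => huniq x ⟨hx.2, hx.1⟩, by rintro rfl; exact ⟨huw, hw⟩⟩

theorem isSkewZeroForcing_of_forall_not_disjoint {Z : Finset V}
    (h : ∀ F : Set V, IsSkewFort G F → ¬ Disjoint (Z : Set V) F) : IsSkewZeroForcing G Z := by
  induction hn : Zᶜ.card using Nat.strong_induction_on generalizing Z with
  | _ n ih =>
    by_cases hZ : Z = Finset.univ
    · rw [hZ]
      exact Relation.ReflTransGen.refl
    obtain ⟨w, hw, hstep⟩ := exists_skewColorChange hZ fun hF => h _ hF disjoint_compl_right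
    have hlt : (insert w Z)ᶜ.card < n :=
      hn ▸ Finset.card_lt_card (Finset.compl_ssubset_compl.2 (Finset.ssubset_insert hw))
    refine Relation.ReflTransGen.head hstep (ih _ hlt (fun F hF hdisj => h F hF ?_) rfl)
    exact hdisj.mono_left (Finset.coe_subset.2 (Finset.subset_insert w Z))

theorem isSkewZeroForcing_iff {Z : Finset V} :
    IsSkewZeroForcing G Z ↔ ∀ F : Set V, IsSkewFort G F → ¬ Disjoint (Z : Set V) F :=
  ⟨fun hZ _ hF => hZ.not_disjoint hF, isSkewZeroForcing_of_forall_not_disjoint⟩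

theorem exists_isSkewFort_subset_iff_not_isSkewZeroForcing_compl {S : Finset V} :
    (∃ F ⊆ S, IsSkewFort G (F : Set V)) ↔ ¬ IsSkewZeroForcing G Sᶜ := by
  classical
  rw [isSkewZeroForcing_iff]
  push Not
  constructor
  · rintro ⟨F, hFS, hF⟩
    exact ⟨F, hF, by simpa [Set.disjoint_compl_left_iff_subset] using hFS⟩
  · rintro ⟨F, hF, hdisj⟩
    refine ⟨F.toFinset, ?_, by simpa using hF⟩
    simpa [Set.disjoint_compl_left_iff_subset, ← Finset.coe_subset] using hdisj

theorem skewZeroForcingSpan_eq_zero_iff_forall :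
    skewZeroForcingSpan G = 0 ↔ ∀ Z F : Finset V, Z.card = F.card →
      IsSkewZeroForcing G Z → IsSkewZeroForcing G F := by
  unfold skewZeroForcingSpan
  rw [Set.ncard_eq_zero ((Set.finite_Iic (Fintype.card V)).subset (by
    rintro k ⟨Z, F, rfl, -⟩
    exact Finset.card_le_univ Z)), Set.eq_empty_iff_forall_notMem]
  constructor
  · intro h Z F hc hZ
    by_contra hF
    exact h F.card ⟨Z, F, hc, rfl, hZ, hF⟩
  · rintro h k ⟨Z, F, rfl, hc, hZ, hF⟩
    exact hF (h Z F hc.symm hZ)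

theorem skewZeroForcingSpan_eq_zero_of_forall_comap_eq
    (hG : ∀ σ : Equiv.Perm V, G.comap σ = G) : skewZeroForcingSpan G = 0 := by
  rw [skewZeroForcingSpan_eq_zero_iff_forall]
  intro Z F hc hZ
  obtain ⟨σ, hσ⟩ : ∃ σ : Equiv.Perm V, ∀ x ∈ Z, σ x ∈ F :=
    ⟨(Finset.equivOfCardEq hc).extendSubtype, fun x => Equiv.extendSubtype_mem _ x⟩
  refine isSkewZeroForcing_iff.2 fun X hX hdisj => hZ.not_disjoint (hG σ ▸ hX.preimage_equiv σ) ?_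
  exact Set.disjoint_left.2 fun x hx => Set.disjoint_left.1 hdisj (hσ x hx)

theorem skewZeroForcingSpan_top : skewZeroForcingSpan (⊤ : SimpleGraph V) = 0 :=
  skewZeroForcingSpan_eq_zero_of_forall_comap_eq fun σ => SimpleGraph.comap_top σ.injective

theorem skewZeroForcingSpan_bot : skewZeroForcingSpan (⊥ : SimpleGraph V) = 0 :=
  skewZeroForcingSpan_eq_zero_of_forall_comap_eq fun σ => SimpleGraph.comap_bot σ

theorem skewZeroForcingSpan_eq_zero_of_forall_not_isSkewFort (h : ∀ F, ¬ IsSkewFort G F) :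
    skewZeroForcingSpan G = 0 :=
  skewZeroForcingSpan_eq_zero_iff_forall.2 fun _ _ _ _ =>
    isSkewZeroForcing_iff.2 fun F hF => absurd hF (h F)

end Forcing

/-- Every set of `f` vertices is a skew fort, and no skew fort has fewer than `f` vertices. -/
structure HasUniformSkewForts {V : Type*} [Fintype V] (G : SimpleGraph V) (f : ℕ) : Prop where
  le_card : f ≤ Fintype.card V
  isSkewFort : ∀ S : Finset V, S.card = f → IsSkewFort G (S : Set V)
  le_of_isSkewFort : ∀ S : Finset V, IsSkewFort G (S : Set V) → f ≤ S.card

section UniformSkewForts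

variable {V : Type*} [Fintype V] [DecidableEq V] {G : SimpleGraph V}

theorem HasUniformSkewForts.skewZeroForcingSpan_eq_zero {f : ℕ} (h : HasUniformSkewForts G f) :
    skewZeroForcingSpan G = 0 := by
  rw [skewZeroForcingSpan_eq_zero_iff_forall]
  intro Z F hc hZ
  by_contra hF
  rw [← compl_compl F, ← exists_isSkewFort_subset_iff_not_isSkewZeroForcing_compl] at hF
  obtain ⟨X, hXF, hX⟩ := hF
  have hle : f ≤ Zᶜ.card := by
    rw [Finset.card_compl, hc, ← Finset.card_compl]
    exact (h.le_of_isSkewFort X hX).trans (Finset.card_le_card hXF)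
  obtain ⟨S, hSZ, hS⟩ := Finset.exists_subset_card_eq hle
  exact hZ.not_disjoint (h.isSkewFort S hS)
    (by exact_mod_cast Finset.disjoint_left.2 fun x hx hxS => Finset.mem_compl.1 (hSZ hxS) hx)

theorem exists_hasUniformSkewForts (h : skewZeroForcingSpan G = 0) {F : Set V}
    (hF : IsSkewFort G F) : ∃ f, HasUniformSkewForts G f := by
  classical
  rw [skewZeroForcingSpan_eq_zero_iff_forall] at h
  obtain ⟨S₀, hS₀, hmin⟩ := exists_minimalFor_of_wellFoundedLT
    (fun S : Finset V => IsSkewFort G (S : Set V)) Finset.card ⟨F.toFinset, by simpa using hF⟩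
  have hle : ∀ S : Finset V, IsSkewFort G (S : Set V) → S₀.card ≤ S.card := fun S hS =>
    (le_total S₀.card S.card).elim id (hmin hS)
  refine ⟨S₀.card, Finset.card_le_univ S₀, fun S hS => ?_, hle⟩
  have hS₀' : ¬ IsSkewZeroForcing G S₀ᶜ :=
    exists_isSkewFort_subset_iff_not_isSkewZeroForcing_compl.1 ⟨S₀, subset_rfl, hS₀⟩
  have hS' : ¬ IsSkewZeroForcing G Sᶜ :=
    mt (h Sᶜ S₀ᶜ (by rw [Finset.card_compl, Finset.card_compl, hS])) hS₀'
  obtain ⟨X, hXS, hX⟩ := exists_isSkewFort_subset_iff_not_isSkewZeroForcing_compl.2 hS'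
  rwa [← Finset.eq_of_subset_of_card_le hXS (hS ▸ hle X hX)]

theorem skewZeroForcingSpan_eq_zero_iff :
    skewZeroForcingSpan G = 0 ↔ (∀ F, ¬ IsSkewFort G F) ∨ ∃ f, HasUniformSkewForts G f := by
  constructor
  · intro h
    rw [or_iff_not_imp_left]
    push Not
    exact fun ⟨F, hF⟩ => exists_hasUniformSkewForts h hF
  · rintro (h | ⟨f, hf⟩)
    · exact skewZeroForcingSpan_eq_zero_of_forall_not_isSkewFort h
    · exact hf.skewZeroForcingSpan_eq_zero

end UniformSkewForts

section Orderable

variable {V : Type*} {G : SimpleGraph V}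

theorem IsTwoSetPerfectlyOrderable.not_isSkewFort (h : IsTwoSetPerfectlyOrderable G)
    (F : Set V) : ¬ IsSkewFort G F := by
  obtain ⟨m, u, w, -, hw, -, hcov, hnb, hadj⟩ := h
  intro hF
  have hwF (i) : w i ∉ F := by
    induction i using WellFoundedLT.induction with
    | _ i ih =>
      intro hi
      obtain ⟨x, hx, hne, ha⟩ := hF.exists_ne_adj hi (hadj i)
      obtain ⟨j, hj, rfl⟩ := hnb i x ha
      exact ih j (lt_of_le_of_ne hj fun h => hne (h ▸ rfl)) hx
  have huF (i) : u i ∉ F := by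
    induction i using WellFoundedGT.induction with
    | _ i ih =>
      intro hi
      obtain ⟨x, hx, hne, ha⟩ := hF.exists_ne_adj hi (hadj i).symm
      rcases hcov.ge (Set.mem_univ x) with ⟨k, rfl⟩ | ⟨k, rfl⟩
      · obtain ⟨j, hj, hj'⟩ := hnb k (w i) ha.symm
        obtain rfl := hw hj'
        exact ih k (lt_of_le_of_ne hj fun h => hne (h ▸ rfl)) hx
      · exact hwF k hx
  obtain ⟨x, hx⟩ := hF.1
  rcases hcov.ge (Set.mem_univ x) with ⟨k, rfl⟩ | ⟨k, rfl⟩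
  · exact huF k hx
  · exact hwF k hx

theorem isTwoSetPerfectlyOrderable_of_isEmpty [IsEmpty V] : IsTwoSetPerfectlyOrderable G :=
  ⟨0, Fin.elim0, Fin.elim0, fun i => i.elim0, fun i => i.elim0, by simp,
    Set.eq_univ_of_forall isEmptyElim, fun i => i.elim0, fun i => i.elim0⟩

theorem exists_isSkewFort_of_induce {a b : V} (hab : G.Adj a b) (ha : ∀ x, G.Adj a x → x = b)
    {F : Set ↥({a, b}ᶜ : Set V)} (hF : IsSkewFort (G.induce {a, b}ᶜ) F) :
    ∃ F', IsSkewFort G F' := by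
  have hanF {x} (hx : x ∈ Subtype.val '' F) : x ≠ a ∧ x ≠ b := by
    obtain ⟨⟨x, hx'⟩, -, rfl⟩ := hx
    simpa [not_or] using hx'
  -- Only the neighbor `b` of the leaf `a` may violate the condition; adding `a` then repairs it.
  have huniq {u w : V} (hw : w ∈ Subtype.val '' F) (huw : G.Adj u w)
      (h : ∀ y ∈ Subtype.val '' F, G.Adj u y → y = w) : u = b := by
    by_contra hub
    have hua : u ≠ a := by
      rintro rfl
      exact (hanF hw).2 (ha w huw)
    obtain ⟨w, hwF, rfl⟩ := hw
    have hu : u ∈ ({a, b}ᶜ : Set V) := by simp [hua, hub]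
    refine hF.2 ⟨u, hu⟩ ⟨w, ⟨hwF, huw⟩, fun y ⟨hy, huy⟩ => ?_⟩
    exact Subtype.ext (h y ⟨y, hy, rfl⟩ huy)
  by_cases hb : ∃! w, w ∈ Subtype.val '' F ∧ G.Adj b w
  · obtain ⟨x, ⟨hx, hbx⟩, -⟩ := hb
    refine ⟨insert a (Subtype.val '' F), Set.insert_nonempty _ _, ?_⟩
    rintro u ⟨w, ⟨hw, huw⟩, h⟩
    have hub : u = b := by
      rcases hw with rfl | hw
      · exact ha u huw.symm
      · exact huniq hw huw fun y hy huy => h y ⟨Or.inr hy, huy⟩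
    subst hub
    have hwa := h a ⟨Or.inl rfl, hab.symm⟩
    exact (hanF hx).1 ((h x ⟨Or.inr hx, hbx⟩).trans hwa.symm)
  · refine ⟨Subtype.val '' F, hF.1.image _, ?_⟩
    rintro u ⟨w, ⟨hw, huw⟩, h⟩
    obtain rfl := huniq hw huw fun y hy huy => h y ⟨hy, huy⟩
    exact hb ⟨w, ⟨hw, huw⟩, h⟩

theorem IsTwoSetPerfectlyOrderable.of_induce {a b : V} (hab : G.Adj a b)
    (ha : ∀ x, G.Adj a x → x = b) (h : IsTwoSetPerfectlyOrderable (G.induce {a, b}ᶜ)) :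
    IsTwoSetPerfectlyOrderable G := by
  obtain ⟨m, u, w, hu, hw, hdisj, hcov, hnb, hadj⟩ := h
  have hne (x : ↥({a, b}ᶜ : Set V)) : (x : V) ≠ a ∧ (x : V) ≠ b := not_or.1 x.2
  refine ⟨m + 1, Fin.cons a fun i => u i, Fin.cons b fun i => w i, ?_, ?_, ?_, ?_, ?_, ?_⟩
  · rw [Fin.cons_injective_iff]
    exact ⟨fun ⟨i, hi⟩ => (hne _).1 hi, Subtype.val_injective.comp hu⟩
  · rw [Fin.cons_injective_iff]
    exact ⟨fun ⟨i, hi⟩ => (hne _).2 hi, Subtype.val_injective.comp hw⟩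
  · rw [Fin.range_cons, Fin.range_cons, Set.disjoint_iff_forall_ne]
    rintro x (rfl | ⟨i, rfl⟩) y (rfl | ⟨j, rfl⟩)
    · exact hab.ne
    · exact (hne _).1.symm
    · exact (hne _).2
    · exact fun h => Set.disjoint_left.1 hdisj ⟨i, rfl⟩ ⟨j, Subtype.ext h.symm⟩
  · rw [Fin.range_cons, Fin.range_cons]
    refine Set.eq_univ_of_forall fun x => ?_
    by_cases hx : x ∈ ({a, b} : Set V)
    · rcases hx with rfl | rfl
      · exact Or.inl (Or.inl rfl)
      · exact Or.inr (Or.inl rfl)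
    · rcases hcov.ge (Set.mem_univ ⟨x, hx⟩) with ⟨i, hi⟩ | ⟨i, hi⟩
      · exact Or.inl (Or.inr ⟨i, congrArg Subtype.val hi⟩)
      · exact Or.inr (Or.inr ⟨i, congrArg Subtype.val hi⟩)
  · refine Fin.cases (fun x hx => ⟨0, le_rfl, ha x hx⟩) fun i x hx => ?_
    rw [Fin.cons_succ] at hx
    by_cases hxb : x = b
    · exact ⟨0, Fin.zero_le _, hxb⟩
    have hxa : x ≠ a := by
      rintro rfl
      exact (hne (u i)).2 (ha _ hx.symm)
    obtain ⟨j, hj, hxj⟩ := hnb i ⟨x, by simpa using ⟨hxa, hxb⟩⟩ hx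
    exact ⟨j.succ, Fin.succ_le_succ_iff.2 hj, congrArg Subtype.val hxj⟩
  · exact Fin.cases hab hadj

theorem isTwoSetPerfectlyOrderable_of_forall_not_isSkewFort [Finite V]
    (h : ∀ F, ¬ IsSkewFort G F) : IsTwoSetPerfectlyOrderable G := by
  induction hn : Nat.card V using Nat.strong_induction_on generalizing V with
  | _ n ih =>
    cases isEmpty_or_nonempty V
    · exact isTwoSetPerfectlyOrderable_of_isEmpty
    obtain ⟨a, b, ⟨-, hab⟩, ha⟩ :=
      exists_existsUnique_of_not_isSkewFort (h Set.univ) Set.univ_nonempty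
    replace ha (x) (hx : G.Adj a x) : x = b := ha x ⟨Set.mem_univ x, hx⟩
    refine .of_induce hab ha (ih _ ?_ (fun F hF => ?_) rfl)
    · exact hn ▸ Finite.card_subtype_lt (x := a) fun h => h (Or.inl rfl)
    · obtain ⟨F', hF'⟩ := exists_isSkewFort_of_induce hab ha hF
      exact h F' hF'

theorem forall_not_isSkewFort_iff [Finite V] :
    (∀ F, ¬ IsSkewFort G F) ↔ IsTwoSetPerfectlyOrderable G :=
  ⟨isTwoSetPerfectlyOrderable_of_forall_not_isSkewFort,
    IsTwoSetPerfectlyOrderable.not_isSkewFort⟩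

end Orderable

theorem exists_eq_triple_of_mem {V : Type*} [DecidableEq V] {s : Finset V} (hs : s.card = 3)
    {a b : V} (ha : a ∈ s) (hb : b ∈ s) (hab : a ≠ b) : ∃ c, s = {a, b, c} := by
  obtain ⟨c, hc⟩ := Finset.card_eq_one.1 (show ((s.erase a).erase b).card = 1 by
    rw [Finset.card_erase_of_mem (Finset.mem_erase.2 ⟨hab.symm, hb⟩),
      Finset.card_erase_of_mem ha, hs])
  refine ⟨c, ?_⟩
  rw [← hc, Finset.insert_erase (Finset.mem_erase.2 ⟨hab.symm, hb⟩), Finset.insert_erase ha]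

theorem HasUniformSkewForts.exists_adj {V : Type*} [Fintype V] {G : SimpleGraph V} {f : ℕ}
    (h : HasUniformSkewForts G f) (hf : 2 ≤ f) (x : V) : ∃ w, G.Adj x w := by
  have hx : ¬ IsSkewFort G ({x} : Set V) := fun hx => by
    have := h.le_of_isSkewFort {x} (by simpa using hx)
    rw [Finset.card_singleton] at this
    omega
  obtain ⟨u, w, ⟨rfl, hwx⟩, -⟩ :=
    exists_existsUnique_of_not_isSkewFort hx (Set.singleton_nonempty x)
  exact ⟨u, hwx.symm⟩

section CommonNeighbors

/-- Every vertex has degree at least `t`, and any `t - 1` vertices have a common neighbor whose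
degree is exactly `t`. With `t = n + 2 - f`, this is what uniform skew forts of size
`2 ≤ f < n` amount to. -/
structure HasCommonNeighbors {V : Type*} [Fintype V] (G : SimpleGraph V) [DecidableRel G.Adj]
    (t : ℕ) : Prop where
  le_degree : ∀ x, t ≤ G.degree x
  exists_common : ∀ T : Finset V, T.card + 1 = t → ∃ x, G.degree x = t ∧ T ⊆ G.neighborFinset x

variable {V : Type*} [Fintype V] {G : SimpleGraph V} [DecidableRel G.Adj]

theorem HasUniformSkewForts.le_degree_add {f : ℕ} (h : HasUniformSkewForts G f) (hf : f ≠ 0)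
    {x w : V} (hxw : G.Adj x w) : Fintype.card V + 2 ≤ G.degree x + f := by
  classical
  by_contra hlt
  have hc : f - 1 ≤ (G.neighborFinset x)ᶜ.card := by
    rw [Finset.card_compl, G.card_neighborFinset_eq_degree]
    omega
  obtain ⟨R, hR, hRc⟩ := Finset.exists_subset_card_eq hc
  have hRx {y} (hy : y ∈ R) : ¬ G.Adj x y := by simpa using hR hy
  have hwR : w ∉ R := fun hw => hRx hw hxw
  have hfort : IsSkewFort G (insert w R : Finset V) :=
    h.isSkewFort _ (by rw [Finset.card_insert_of_notMem hwR]; omega)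
  obtain ⟨w', hw', hne, ha⟩ := hfort.exists_ne_adj (Finset.mem_insert_self w R) hxw
  exact hRx ((Finset.mem_insert.1 hw').resolve_left hne) ha

theorem exists_common_neighbor {t : ℕ} (hdeg : ∀ x, t ≤ G.degree x) {T : Finset V}
    (hT : T.card + 1 = t) (hne : T ≠ Finset.univ) (hfort : ¬ IsSkewFort G (T : Set V)ᶜ) :
    ∃ x, G.degree x = t ∧ T ⊆ G.neighborFinset x := by
  classical
  obtain ⟨u, w, ⟨hw, -⟩, huniq⟩ := exists_existsUnique_of_not_isSkewFort hfort
    (by rwa [Set.nonempty_compl, ne_eq, Finset.coe_eq_univ])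
  have hsub : G.neighborFinset u ⊆ insert w T := by
    intro y hy
    rw [SimpleGraph.mem_neighborFinset] at hy
    by_cases hyT : y ∈ T
    · exact Finset.mem_insert_of_mem hyT
    · exact Finset.mem_insert.2 (Or.inl (huniq y ⟨hyT, hy⟩))
  have hcard : (insert w T).card = t := by rw [Finset.card_insert_of_notMem hw, hT]
  have heq : G.neighborFinset u = insert w T := by
    apply Finset.eq_of_subset_of_card_le hsub
    rw [hcard, G.card_neighborFinset_eq_degree]
    exact hdeg u
  refine ⟨u, ?_, heq ▸ Finset.subset_insert w T⟩
  rw [← G.card_neighborFinset_eq_degree, heq, hcard]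

theorem HasUniformSkewForts.hasCommonNeighbors {f t : ℕ} (h : HasUniformSkewForts G f)
    (hf : 2 ≤ f) (ht : t + f = Fintype.card V + 2) : HasCommonNeighbors G t := by
  classical
  have hdeg (x) : t ≤ G.degree x := by
    obtain ⟨w, hw⟩ := h.exists_adj hf x
    have := h.le_degree_add (by omega) hw
    omega
  refine ⟨hdeg, fun T hT => exists_common_neighbor hdeg hT ?_ fun hfort => ?_⟩
  · rw [← Finset.card_lt_iff_ne_univ]
    omega
  · have := h.le_of_isSkewFort Tᶜ (by simpa using hfort)
    rw [Finset.card_compl] at this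
    omega

theorem HasCommonNeighbors.exists_degree_eq {t : ℕ} (h : HasCommonNeighbors G t) (ht : t ≠ 0)
    (htn : t ≤ Fintype.card V) : ∃ v, G.degree v = t := by
  obtain ⟨T, -, hT⟩ := Finset.exists_subset_card_eq
    (show t - 1 ≤ (Finset.univ : Finset V).card by rw [Finset.card_univ]; omega)
  obtain ⟨v, hv, -⟩ := h.exists_common T (by omega)
  exact ⟨v, hv⟩

theorem HasCommonNeighbors.add_one_eq_card_of_isClique {t : ℕ} (h : HasCommonNeighbors G t)
    {s : Finset V} (hs : G.IsClique (s : Set V)) (hst : s.card + t = Fintype.card V + 1) :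
    t + 1 = Fintype.card V := by
  classical
  have hle := s.card_le_univ
  obtain ⟨x, hx, hxs⟩ := h.exists_common sᶜ (by rw [Finset.card_compl]; omega)
  simp only [Finset.subset_iff, Finset.mem_compl, SimpleGraph.mem_neighborFinset] at hxs
  have hmem : x ∈ s := by
    by_contra hx
    exact (hxs hx).ne rfl
  have huniv (y) (hy : x ≠ y) : G.Adj x y := by
    by_cases hys : y ∈ s
    · exact hs hmem hys hy
    · exact hxs hys
  rw [← hx, (G.degree_eq_card_sub_one x).2 fun y hy => huniv y hy]
  have := Fintype.card_pos_iff.2 ⟨x⟩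
  omega

theorem eq_top_of_card_le_degree_add_one (h : ∀ x, Fintype.card V ≤ G.degree x + 1) : G = ⊤ := by
  classical
  ext a b
  rw [SimpleGraph.top_adj]
  refine ⟨fun hab => hab.ne, fun hab => (G.degree_eq_card_sub_one a).1 ?_ hab⟩
  have := G.degree_lt_card_verts a
  have := h a
  omega

theorem exists_isNClique_three [Nonempty V] (h : ∀ x, Fintype.card V < 2 * G.degree x) :
    ∃ s, G.IsNClique 3 s := by
  classical
  obtain ⟨a⟩ := ‹Nonempty V›
  have hdeg : 0 < G.degree a := by
    have := h a
    omega
  obtain ⟨b, hab⟩ := (G.degree_pos_iff_exists_adj a).1 hdeg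
  have hinter : 0 < (G.neighborFinset a ∩ G.neighborFinset b).card := by
    have h1 := Finset.card_union_add_card_inter (G.neighborFinset a) (G.neighborFinset b)
    have h2 := Finset.card_le_univ (G.neighborFinset a ∪ G.neighborFinset b)
    rw [G.card_neighborFinset_eq_degree, G.card_neighborFinset_eq_degree] at h1
    have := h a
    have := h b
    omega
  obtain ⟨c, hc⟩ := Finset.card_pos.1 hinter
  rw [Finset.mem_inter, SimpleGraph.mem_neighborFinset, SimpleGraph.mem_neighborFinset] at hc
  exact ⟨{a, b, c}, SimpleGraph.is3Clique_triple_iff.2 ⟨hab, hc.1, hc.2⟩⟩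

theorem HasCommonNeighbors.choose_le {k : ℕ} (h : HasCommonNeighbors G (k + 2)) (v : V) :
    (Fintype.card V - 1).choose k ≤
      {x ∈ G.neighborFinset v | G.degree x = k + 2}.card * (k + 1) := by
  classical
  have hsub : (Finset.univ.erase v).powersetCard k ⊆
      {x ∈ G.neighborFinset v | G.degree x = k + 2}.biUnion
        fun x => ((G.neighborFinset x).erase v).powersetCard k := by
    intro T hT
    rw [Finset.mem_powersetCard] at hT
    have hvT : v ∉ T := fun hv => (Finset.mem_erase.1 (hT.1 hv)).1 rfl
    obtain ⟨x, hx, hxT⟩ :=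
      h.exists_common (insert v T) (by rw [Finset.card_insert_of_notMem hvT, hT.2])
    rw [Finset.insert_subset_iff, SimpleGraph.mem_neighborFinset] at hxT
    refine Finset.mem_biUnion.2 ⟨x, ?_, Finset.mem_powersetCard.2 ⟨?_, hT.2⟩⟩
    · simpa [hx] using hxT.1.symm
    · exact Finset.subset_erase.2 ⟨hxT.2, hvT⟩
  have hcard := (Finset.card_le_card hsub).trans
    (Finset.card_biUnion_le_card_mul _ _ (k + 1) fun x hx => ?_)
  · rwa [Finset.card_powersetCard, Finset.card_erase_of_mem (Finset.mem_univ v),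
      Finset.card_univ] at hcard
  · rw [Finset.mem_filter, SimpleGraph.mem_neighborFinset] at hx
    rw [Finset.card_powersetCard, Finset.card_erase_of_mem (by simpa using hx.1.symm),
      G.card_neighborFinset_eq_degree, hx.2]
    exact (Nat.choose_succ_self_right k).le

theorem le_one_of_choose_le {n k : ℕ} (hn : k + 4 ≤ n) (h : n.choose k ≤ (k + 2) * (k + 1)) :
    k ≤ 1 := by
  have hchoose : (k + 4).choose 4 ≤ (k + 2) * (k + 1) := by
    rw [← Nat.choose_symm_add]
    exact (Nat.choose_le_choose k hn).trans h
  have hdesc : (k + 4) * (k + 3) * ((k + 2) * (k + 1)) = 24 * (k + 4).choose 4 := by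
    rw [show 24 = Nat.factorial 4 from rfl, ← Nat.descFactorial_eq_factorial_mul_choose]
    simp only [Nat.descFactorial, Nat.reduceSubDiff, Nat.sub_zero]
    ring
  have hle : (k + 4) * (k + 3) ≤ 24 :=
    Nat.le_of_mul_le_mul_right (by omega : _ ≤ 24 * ((k + 2) * (k + 1))) (by positivity)
  by_contra hk
  have : 6 * 5 ≤ (k + 4) * (k + 3) := Nat.mul_le_mul (by omega) (by omega)
  omega

theorem HasCommonNeighbors.eq_one_of_add_five_le {k : ℕ} (h : HasCommonNeighbors G (k + 2))
    (hk : k ≠ 0) (hn : k + 5 ≤ Fintype.card V) : k = 1 := by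
  obtain ⟨v, hv⟩ := h.exists_degree_eq (by omega) (by omega)
  have hle : {x ∈ G.neighborFinset v | G.degree x = k + 2}.card ≤ k + 2 := by
    rw [← hv, ← G.card_neighborFinset_eq_degree]
    exact Finset.card_filter_le _ _
  have := le_one_of_choose_le (by omega)
    ((h.choose_le v).trans (Nat.mul_le_mul_right (k + 1) hle))
  omega

theorem HasCommonNeighbors.degree_eq_three_of_adj (h : HasCommonNeighbors G 3)
    (hn : 6 ≤ Fintype.card V) {v a : V} (hv : G.degree v = 3) (hva : G.Adj v a) :
    G.degree a = 3 := by
  have hcard : (G.neighborFinset v).card ≤ {x ∈ G.neighborFinset v | G.degree x = 3}.card := by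
    have hle := h.choose_le (k := 1) v
    simp only [Nat.choose_one_right, Nat.reduceAdd] at hle
    rw [G.card_neighborFinset_eq_degree, hv]
    omega
  have heq := Finset.eq_of_subset_of_card_le (Finset.filter_subset _ _) hcard
  exact Finset.filter_eq_self.1 heq a (by simpa using hva)

theorem HasCommonNeighbors.exists_common_pair (h : HasCommonNeighbors G 3) {x y : V}
    (hxy : x ≠ y) : ∃ z ∈ G.neighborFinset x, y ∈ G.neighborFinset z := by
  classical
  obtain ⟨z, -, hz⟩ := h.exists_common {x, y} (by rw [Finset.card_pair hxy])
  simp only [Finset.insert_subset_iff, Finset.singleton_subset_iff,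
    SimpleGraph.mem_neighborFinset] at hz
  exact ⟨z, by simpa using hz.1.symm, by simpa using hz.2⟩

theorem HasCommonNeighbors.card_lt_six_of_neighborFinset_eq [DecidableEq V]
    (h : HasCommonNeighbors G 3) {v a b c y z : V}
    (hv : G.neighborFinset v = {a, b, c}) (ha : G.neighborFinset a = {v, b, c})
    (hb : G.neighborFinset b = {v, a, y}) (hc : G.neighborFinset c = {v, a, z}) :
    Fintype.card V < 6 := by
  by_contra! hn
  have hcover (x : V) : x ∈ ({y, v, a, b, c, z} : Finset V) := by
    rcases eq_or_ne v x with rfl | hvx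
    · simp
    obtain ⟨w, hw, hx⟩ := h.exists_common_pair hvx
    simp only [hv, Finset.mem_insert, Finset.mem_singleton] at hw
    rcases hw with rfl | rfl | rfl <;> grind
  have hy : y ∉ ({v, a, b, c, z} : Finset V) := by
    intro hy
    rw [← Finset.card_univ, ← Finset.eq_univ_iff_forall.2 hcover, Finset.insert_eq_of_mem hy] at hn
    exact absurd (hn.trans Finset.card_le_five) (by norm_num)
  have hNy : G.neighborFinset y ⊆ {b, z} := by
    intro w hw
    have hwy : y ∈ G.neighborFinset w := by
      rw [SimpleGraph.mem_neighborFinset] at hw ⊢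
      exact hw.symm
    have hwy' : w ≠ y := by
      rintro rfl
      simp at hw
    have hwV := hcover w
    grind
  have hle := (Finset.card_le_card hNy).trans Finset.card_le_two
  rw [G.card_neighborFinset_eq_degree] at hle
  have := h.le_degree y
  omega

theorem HasCommonNeighbors.exists_adj_adj [DecidableEq V] (h : HasCommonNeighbors G 3)
    {v : V} (hv : G.degree v = 3) : ∃ a b c, b ≠ c ∧ G.neighborFinset v = {a, b, c} ∧
      G.Adj a b ∧ G.Adj a c := by
  obtain ⟨a, b, c, hab, hac, hbc, hN⟩ := Finset.card_eq_three.1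
    ((G.card_neighborFinset_eq_degree v).trans hv)
  have htriangle (x) (hx : G.Adj v x) : G.Adj a x ∨ G.Adj b x ∨ G.Adj c x := by
    obtain ⟨y, hy, hxy⟩ := h.exists_common_pair hx.ne
    simpa [hN] using show ∃ y ∈ G.neighborFinset v, G.Adj y x from ⟨y, hy, by simpa using hxy⟩
  have hadj {x} : G.Adj v x ↔ x = a ∨ x = b ∨ x = c := by
    rw [← SimpleGraph.mem_neighborFinset, hN]
    simp
  have ha := htriangle a (hadj.2 (Or.inl rfl))
  have hb := htriangle b (hadj.2 (Or.inr (Or.inl rfl)))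
  have hc := htriangle c (hadj.2 (Or.inr (Or.inr rfl)))
  simp only [SimpleGraph.irrefl, false_or, or_false, G.adj_comm b a, G.adj_comm c] at ha hb hc
  by_cases hab' : G.Adj a b
  · by_cases hac' : G.Adj a c
    · exact ⟨a, b, c, hbc, hN, hab', hac'⟩
    · exact ⟨b, a, c, hac, hN.trans (Finset.insert_comm a b {c}), hab'.symm,
        hc.resolve_left hac'⟩
  · have hac' := ha.resolve_left hab'
    have hbc' := hb.resolve_left hab'
    exact ⟨c, a, b, hab, by rw [hN]; grind, hac'.symm, hbc'.symm⟩

theorem HasCommonNeighbors.card_lt_six (h : HasCommonNeighbors G 3) : Fintype.card V < 6 := by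
  classical
  by_contra! hn
  obtain ⟨v, hv⟩ := h.exists_degree_eq (by norm_num) (by omega)
  obtain ⟨a, b, c, hbc, hN, hab, hac⟩ := h.exists_adj_adj hv
  have hva : G.Adj v a := by simp [← G.mem_neighborFinset, hN]
  have hvb : G.Adj v b := by simp [← G.mem_neighborFinset, hN]
  have hvc : G.Adj v c := by simp [← G.mem_neighborFinset, hN]
  have hcard {x} (hx : G.Adj v x) : (G.neighborFinset x).card = 3 :=
    (G.card_neighborFinset_eq_degree x).trans (h.degree_eq_three_of_adj hn hv hx)
  have hNa : G.neighborFinset a = {v, b, c} := by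
    refine (Finset.eq_of_subset_of_card_le ?_ ?_).symm
    · simp [Finset.insert_subset_iff, hva.symm, hab, hac]
    · rw [hcard hva, Finset.card_eq_three.2 ⟨v, b, c, hvb.ne, hvc.ne, hbc, rfl⟩]
  obtain ⟨y, hNb⟩ := exists_eq_triple_of_mem (hcard hvb) (a := v) (b := a)
    (by simpa using hvb.symm) (by simpa using hab.symm) hva.ne
  obtain ⟨z, hNc⟩ := exists_eq_triple_of_mem (hcard hvc) (a := v) (b := a)
    (by simpa using hvc.symm) (by simpa using hac.symm) hva.ne
  exact hn.not_gt (h.card_lt_six_of_neighborFinset_eq hN hNa hNb hNc)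

theorem HasCommonNeighbors.eq_top {t : ℕ} (h : HasCommonNeighbors G t) (ht : 3 ≤ t)
    (htn : t ≤ Fintype.card V) : G = ⊤ := by
  obtain ⟨v, hv⟩ := h.exists_degree_eq (by omega) htn
  have hlt : t < Fintype.card V := hv ▸ G.degree_lt_card_verts v
  obtain htop | htri | hsmall : t + 1 = Fintype.card V ∨ t + 2 = Fintype.card V ∨
    t + 3 ≤ Fintype.card V := by omega
  · refine eq_top_of_card_le_degree_add_one fun x => ?_
    have := h.le_degree x
    omega
  · have : Nonempty V := ⟨v⟩
    obtain ⟨s, hs⟩ := exists_isNClique_three (G := G) fun x => by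
      have := h.le_degree x
      omega
    have := h.add_one_eq_card_of_isClique hs.isClique (by rw [hs.card_eq]; omega)
    omega
  · obtain ⟨k, rfl⟩ : ∃ k, t = k + 2 := ⟨t - 2, by omega⟩
    obtain rfl := h.eq_one_of_add_five_le (by omega) (by omega)
    have := h.card_lt_six
    omega

end CommonNeighbors

theorem HasUniformSkewForts.eq_top {V : Type*} [Fintype V] {G : SimpleGraph V} {f : ℕ}
    (h : HasUniformSkewForts G f) (hf : 2 ≤ f) (hfn : f < Fintype.card V) : G = ⊤ := by
  classical
  exact (h.hasCommonNeighbors (t := Fintype.card V + 2 - f) hf (by omega)).eq_top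
    (by omega) (by omega)

open SimpleGraph

section Threads

variable {V : Type*} {G : SimpleGraph V} {H : Set V} {s t : V} {p : G.Walk s t}

/-- `H` contains every vertex whose degree differs from two, so that a walk cannot branch
outside `H`. -/
def IsBranchCover (G : SimpleGraph V) (H : Set V) : Prop :=
  ∀ x ∉ H, (G.neighborSet x).ncard = 2

theorem IsBranchCover.nontrivial_neighborSet (hH : IsBranchCover G H) {x : V} (hx : x ∉ H) :
    (G.neighborSet x).Nontrivial :=
  (Set.one_lt_ncard_iff_nontrivial_and_finite.1 (by rw [hH x hx]; exact one_lt_two)).1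

theorem eq_or_eq_of_ncard_neighborSet_eq_two {x y z w : V} (hx : (G.neighborSet x).ncard = 2)
    (hy : G.Adj x y) (hz : G.Adj x z) (hyz : y ≠ z) (hw : G.Adj x w) : w = y ∨ w = z := by
  obtain ⟨a, b, -, hab⟩ := Set.ncard_eq_two.1 hx
  have h (v) (hv : G.Adj x v) : v = a ∨ v = b := hab.subset hv
  grind

/-- A non-backtracking walk that starts at a vertex of `H` and avoids `H` between its ends; its
end may lie in `H` or not, so that these walks can be extended step by step to threads. -/
structure IsThreadPrefix (H : Set V) {s t : V} (p : G.Walk s t) : Prop where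
  start_mem : s ∈ H
  pos : 0 < p.length
  notMem : ∀ i, 0 < i → i < p.length → p.getVert i ∉ H
  ne : ∀ i, i + 2 ≤ p.length → p.getVert i ≠ p.getVert (i + 2)

/-- A thread is a non-backtracking walk of positive length between vertices of `H` whose inner
vertices lie outside `H`; over a set containing the vertices of degree other than two, these are
the subdivided edges from which the graph is built. -/
structure IsThread (H : Set V) {s t : V} (p : G.Walk s t) : Prop extends IsThreadPrefix H p where
  end_mem : t ∈ H

namespace IsThreadPrefix

theorem adj_start (hp : IsThreadPrefix H p) : G.Adj s (p.getVert 1) := by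
  simpa using p.adj_getVert_succ hp.pos

theorem mk_getVert_one_mem_edges (hp : IsThreadPrefix H p) : s(s, p.getVert 1) ∈ p.edges :=
  (Walk.mk_mem_edges_iff_exists p).2 ⟨0, hp.pos, by simp⟩

theorem eq_of_adj_inner (hH : IsBranchCover G H) (hp : IsThreadPrefix H p) {i : ℕ}
    (hi : i + 2 ≤ p.length) {y : V} (hy : G.Adj (p.getVert (i + 1)) y) :
    y = p.getVert i ∨ y = p.getVert (i + 2) :=
  eq_or_eq_of_ncard_neighborSet_eq_two (hH _ (hp.notMem (i + 1) (by omega) (by omega)))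
    (p.adj_getVert_succ (by omega)).symm (p.adj_getVert_succ (by omega)) (hp.ne i hi) hy

/-- Two equal vertices would have equal predecessors, or the walk would backtrack. -/
theorem getVert_ne (hH : IsBranchCover G H) (hp : IsThreadPrefix H p) {i j : ℕ} (hi : 0 < i)
    (hij : i < j) (hj : j ≤ p.length) : p.getVert i ≠ p.getVert j := by
  induction j using Nat.strong_induction_on generalizing i with
  | _ j ih =>
    obtain ⟨i, rfl⟩ : ∃ k, i = k + 1 := ⟨i - 1, by omega⟩
    obtain ⟨j, rfl⟩ : ∃ k, j = k + 1 := ⟨j - 1, by omega⟩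
    intro h
    have hadj : G.Adj (p.getVert (i + 1)) (p.getVert j) :=
      h ▸ (p.adj_getVert_succ (by omega)).symm
    rcases hp.eq_of_adj_inner hH (by omega) hadj with h' | h'
    · rcases Nat.eq_zero_or_pos i with rfl | hi
      · exact hp.notMem j (by omega) (by omega) (by simpa [h'] using hp.start_mem)
      · exact ih j (by omega) hi (by omega) (by omega) h'.symm
    · rcases lt_trichotomy (i + 2) j with hlt | rfl | hlt
      · exact ih j (by omega) (by omega) hlt (by omega) h'.symm
      · exact hp.ne (i + 1) (by omega) h
      · obtain rfl : j = i + 1 := by omega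
        exact hadj.ne rfl

theorem isPath_tail (hH : IsBranchCover G H) (hp : IsThreadPrefix H p) : p.tail.IsPath := by
  have hlen : p.tail.length + 1 = p.length :=
    Walk.length_tail_add_one (Walk.not_nil_iff_lt_length.2 hp.pos)
  refine (Walk.IsPath.getVert_injOn_iff _).1 fun i hi j hj hij => ?_
  rw [Set.mem_ofPred_eq] at hi hj
  rw [Walk.getVert_tail, Walk.getVert_tail] at hij
  by_contra hne
  rcases lt_or_gt_of_ne hne with h | h
  · exact hp.getVert_ne hH (by omega) (by omega) (by omega) hij
  · exact hp.getVert_ne hH (by omega) (by omega) (by omega) hij.symm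

theorem getVert_concat {z : V} (htz : G.Adj t z) {i : ℕ} (hi : i ≤ p.length) :
    (p.concat htz).getVert i = p.getVert i := by
  rcases hi.lt_or_eq with h | rfl
  · rw [Walk.concat_eq_append, Walk.getVert_append, if_pos h]
  · simp [Walk.concat_eq_append, Walk.getVert_append]

theorem concat (hp : IsThreadPrefix H p) (ht : t ∉ H) {z : V} (htz : G.Adj t z)
    (hz : z ≠ p.getVert (p.length - 1)) : IsThreadPrefix H (p.concat htz) where
  start_mem := hp.start_mem
  pos := by simp
  notMem i h0 hi := by
    rw [Walk.length_concat] at hi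
    rw [getVert_concat htz (by omega)]
    rcases (Nat.lt_succ_iff.1 hi).lt_or_eq with h | rfl
    · exact hp.notMem i h0 h
    · rwa [p.getVert_length]
  ne i hi := by
    rw [Walk.length_concat] at hi
    rw [getVert_concat htz (by omega)]
    rcases hi.lt_or_eq with h | h
    · rw [getVert_concat htz (by omega)]
      exact hp.ne i (by omega)
    · obtain rfl : i = p.length - 1 := by omega
      rw [h, ← Walk.length_concat p htz, Walk.getVert_length]
      exact hz.symm

theorem exists_succ (hH : IsBranchCover G H) (hp : IsThreadPrefix H p) (ht : t ∉ H) :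
    ∃ (t' : V) (q : G.Walk s t'), IsThreadPrefix H q ∧ q.length = p.length + 1 ∧
      q.getVert 1 = p.getVert 1 := by
  obtain ⟨z, htz, hz⟩ := (hH.nontrivial_neighborSet ht).exists_ne (p.getVert (p.length - 1))
  exact ⟨z, p.concat htz, hp.concat ht htz hz, p.length_concat htz, getVert_concat htz hp.pos⟩

end IsThreadPrefix

namespace IsThread

theorem of_isPath (hp : p.IsPath) (hst : s ≠ t) (hs : s ∈ H) (ht : t ∈ H)
    (hin : ∀ x ∈ p.support, x ≠ s → x ≠ t → x ∉ H) : IsThread H p where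
  start_mem := hs
  end_mem := ht
  pos := Nat.pos_of_ne_zero fun h => hst (Walk.eq_of_length_eq_zero h)
  notMem i h0 hi := hin _ (p.getVert_mem_support i)
    (mt (hp.getVert_eq_start_iff hi.le).1 h0.ne') (mt (hp.getVert_eq_end_iff hi.le).1 hi.ne)
  ne i hi h := by
    have := hp.getVert_injOn (show i ≤ p.length by omega) hi h
    omega

theorem of_isCycle {p : G.Walk s s} (hp : p.IsCycle) (hs : s ∈ H)
    (hin : ∀ x ∈ p.support, x ≠ s → x ∉ H) : IsThread H p where
  start_mem := hs
  end_mem := hs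
  pos := by have := hp.three_le_length; omega
  notMem i h0 hi := hin _ (p.getVert_mem_support i) fun h => by
    rw [hp.getVert_endpoint_iff hi.le] at h
    omega
  ne i hi := hp.getVert_sub_one_ne_getVert_add_one (i := i + 1) (by omega)

theorem isPath (hH : IsBranchCover G H) (hp : IsThread H p) (hst : s ≠ t) : p.IsPath := by
  have hnil : ¬ p.Nil := Walk.not_nil_of_ne hst
  rw [← p.cons_tail_eq hnil, Walk.cons_isPath_iff]
  refine ⟨hp.isPath_tail hH, fun hs => ?_⟩
  obtain ⟨i, hi, hil⟩ := Walk.mem_support_iff_exists_getVert.1 hs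
  have hlen := Walk.length_tail_add_one hnil
  rw [Walk.getVert_tail] at hi
  rcases (show i + 1 ≤ p.length by omega).lt_or_eq with h | h
  · exact hp.notMem _ (by omega) h (hi.symm ▸ hp.start_mem)
  · rw [h, p.getVert_length] at hi
    exact hst hi.symm

theorem isCycle (hH : IsBranchCover G H) {p : G.Walk s s} (hp : IsThread H p) : p.IsCycle := by
  rw [Walk.isCycle_iff_isPath_tail_and_le_length]
  refine ⟨hp.isPath_tail hH, ?_⟩
  by_contra hlt
  have hpos := hp.pos
  obtain h | h : p.length = 1 ∨ p.length = 2 := by omega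
  · have hadj := hp.adj_start
    rw [← h, p.getVert_length] at hadj
    exact hadj.ne rfl
  · have hne := hp.ne 0 h.ge
    rw [zero_add, ← h, p.getVert_zero, p.getVert_length] at hne
    exact hne rfl

/-- A maximal non-backtracking walk along the edge ends in `H`, as it cannot repeat a vertex. -/
theorem exists_of_adj [Finite V] (hH : IsBranchCover G H) {x : V} (hs : s ∈ H)
    (hsx : G.Adj s x) : ∃ (t : V) (p : G.Walk s t), IsThread H p ∧ p.getVert 1 = x := by
  have := Fintype.ofFinite V
  by_contra! hno
  have hlong (n : ℕ) : ∃ (t : V) (p : G.Walk s t), IsThreadPrefix H p ∧ p.length = n + 1 ∧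
      p.getVert 1 = x := by
    induction n with
    | zero => exact ⟨x, hsx.toWalk, ⟨hs, by simp, by simp; omega, by simp⟩, by simp, by simp⟩
    | succ n ih =>
      obtain ⟨t, p, hp, hlen, h1⟩ := ih
      obtain ⟨t', q, hq, hqlen, hq1⟩ := hp.exists_succ hH fun ht => hno t p ⟨hp, ht⟩ h1
      exact ⟨t', q, hq, by omega, hq1.trans h1⟩
  obtain ⟨t, p, hp, hlen, -⟩ := hlong (Fintype.card V)
  have hlt := (hp.isPath_tail hH).length_lt
  have := Walk.length_tail_add_one (Walk.not_nil_iff_lt_length.2 hp.pos)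
  omega

theorem reverse (hp : IsThread H p) : IsThread H p.reverse where
  start_mem := hp.end_mem
  end_mem := hp.start_mem
  pos := by simpa using hp.pos
  notMem i h0 hi := by
    rw [Walk.length_reverse] at hi
    rw [Walk.getVert_reverse]
    exact hp.notMem _ (by omega) (by omega)
  ne i hi := by
    rw [Walk.length_reverse] at hi
    rw [Walk.getVert_reverse, Walk.getVert_reverse, show p.length - i = p.length - (i + 2) + 2 by
      omega]
    exact (hp.ne _ (by omega)).symm

theorem getVert_one_reverse : p.reverse.getVert 1 = p.getVert (p.length - 1) :=
  Walk.getVert_reverse _ _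

theorem adj_end (hp : IsThread H p) : G.Adj t (p.getVert (p.length - 1)) :=
  getVert_one_reverse ▸ hp.reverse.adj_start

theorem exists_inner (hp : IsThread H p) {x : V} (hx : x ∈ p.support) (hxH : x ∉ H) :
    ∃ i, 0 < i ∧ i < p.length ∧ p.getVert i = x := by
  obtain ⟨i, rfl, hi⟩ := Walk.mem_support_iff_exists_getVert.1 hx
  refine ⟨i, Nat.pos_of_ne_zero ?_, lt_of_le_of_ne hi ?_, rfl⟩
  · rintro rfl
    exact hxH (by simpa using hp.start_mem)
  · rintro rfl
    exact hxH (by simpa using hp.end_mem)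

theorem mem_edges_of_adj (hH : IsBranchCover G H) (hp : IsThread H p) {x y : V}
    (hx : x ∈ p.support) (hxH : x ∉ H) (hxy : G.Adj x y) : s(x, y) ∈ p.edges := by
  obtain ⟨i, h0, hi, rfl⟩ := hp.exists_inner hx hxH
  obtain ⟨j, rfl⟩ : ∃ j, i = j + 1 := ⟨i - 1, by omega⟩
  rw [Walk.mk_mem_edges_iff_exists]
  rcases hp.eq_of_adj_inner hH (by omega) hxy with rfl | rfl
  · exact ⟨j, by omega, Sym2.eq_swap⟩
  · exact ⟨j + 1, hi, rfl⟩

theorem eq_of_mem_edges (hp : IsThread H p) {h y : V} (hh : h ∈ H) (he : s(h, y) ∈ p.edges) :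
    (h = s ∧ y = p.getVert 1) ∨ (h = t ∧ y = p.getVert (p.length - 1)) := by
  obtain ⟨i, hi, he⟩ := (Walk.mk_mem_edges_iff_exists p).1 he
  rcases Sym2.eq_iff.1 he with ⟨rfl, rfl⟩ | ⟨rfl, rfl⟩
  · rcases Nat.eq_zero_or_pos i with rfl | h0
    · exact Or.inl (by simp)
    · exact absurd hh (hp.notMem i h0 hi)
  · rcases (show i + 1 ≤ p.length from hi).lt_or_eq with h | h
    · exact absurd hh (hp.notMem _ (by omega) h)
    · exact Or.inr ⟨by rw [h, p.getVert_length], by rw [← h, Nat.add_sub_cancel]⟩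

section SameStart

variable {t' : V} {q : G.Walk s t'}

theorem getVert_eq (hH : IsBranchCover G H) (hp : IsThread H p) (hq : IsThread H q)
    (h1 : p.getVert 1 = q.getVert 1) {i : ℕ} (hip : i ≤ p.length) (hiq : i ≤ q.length) :
    p.getVert i = q.getVert i := by
  induction i using Nat.strong_induction_on with
  | _ i ih =>
    match i with
    | 0 => simp
    | 1 => exact h1
    | j + 2 =>
      have hadj := p.adj_getVert_succ (i := j + 1) (by omega)
      rw [ih (j + 1) (by omega) (by omega) (by omega)] at hadj
      refine (hq.eq_of_adj_inner hH hiq hadj).resolve_left fun h => hp.ne j hip ?_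
      rw [ih j (by omega) (by omega) (by omega), h]

theorem length_le (hH : IsBranchCover G H) (hp : IsThread H p) (hq : IsThread H q)
    (h1 : p.getVert 1 = q.getVert 1) : p.length ≤ q.length := by
  by_contra! h
  refine hp.notMem _ hq.pos h ?_
  rw [hp.getVert_eq hH hq h1 h.le le_rfl, q.getVert_length]
  exact hq.end_mem

theorem length_eq (hH : IsBranchCover G H) (hp : IsThread H p) (hq : IsThread H q)
    (h1 : p.getVert 1 = q.getVert 1) : p.length = q.length :=
  (hp.length_le hH hq h1).antisymm (hq.length_le hH hp h1.symm)

theorem end_eq (hH : IsBranchCover G H) (hp : IsThread H p) (hq : IsThread H q)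
    (h1 : p.getVert 1 = q.getVert 1) : t = t' := by
  have hl := hp.length_eq hH hq h1
  have h := hp.getVert_eq hH hq h1 le_rfl hl.le
  rwa [p.getVert_length, hl, q.getVert_length] at h

theorem eq_of_getVert_one {q : G.Walk s t} (hH : IsBranchCover G H) (hp : IsThread H p)
    (hq : IsThread H q) (h1 : p.getVert 1 = q.getVert 1) : p = q :=
  have hl := hp.length_eq hH hq h1
  Walk.ext_getVert_le_length hl fun _ hi => hp.getVert_eq hH hq h1 hi (hi.trans hl.le)

theorem eq_of_getVert_pred {q : G.Walk s t} (hH : IsBranchCover G H) (hp : IsThread H p)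
    (hq : IsThread H q) (h : p.getVert (p.length - 1) = q.getVert (q.length - 1)) : p = q :=
  Walk.reverse_injective <| hp.reverse.eq_of_getVert_one hH hq.reverse <| by
    rwa [getVert_one_reverse, getVert_one_reverse]

end SameStart

end IsThread

end Threads

section ThreadParity

variable {V : Type*} {G : SimpleGraph V} {H : Set V} {s t : V} {p : G.Walk s t}

/-- `f` takes a single value on the neighborhood of each vertex outside `H`. Such functions, like
membership in a skew fort, are determined along a thread by two consecutive values. -/
def IsConstOnNeighbors {α : Type*} (G : SimpleGraph V) (H : Set V) (f : V → α) : Prop :=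
  ∀ x ∉ H, ∀ y z, G.Adj x y → G.Adj x z → f y = f z

namespace IsThread

section

variable {α : Type*} {f : V → α}

theorem apply_add_two (hp : IsThread H p) (hf : IsConstOnNeighbors G H f) {i : ℕ}
    (hi : i + 2 ≤ p.length) : f (p.getVert (i + 2)) = f (p.getVert i) :=
  hf _ (hp.notMem (i + 1) (by omega) (by omega)) _ _
    (p.adj_getVert_succ (by omega)) (p.adj_getVert_succ (by omega)).symm

theorem apply_two_mul (hp : IsThread H p) (hf : IsConstOnNeighbors G H f) {i : ℕ}
    (hi : 2 * i ≤ p.length) : f (p.getVert (2 * i)) = f s := by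
  induction i with
  | zero => simp
  | succ i ih => exact (hp.apply_add_two hf hi).trans (ih (by omega))

theorem apply_two_mul_add_one (hp : IsThread H p) (hf : IsConstOnNeighbors G H f) {i : ℕ}
    (hi : 2 * i + 1 ≤ p.length) : f (p.getVert (2 * i + 1)) = f (p.getVert 1) := by
  induction i with
  | zero => rfl
  | succ i ih => exact (hp.apply_add_two hf hi).trans (ih (by omega))

theorem apply_end_of_odd (hp : IsThread H p) (hf : IsConstOnNeighbors G H f)
    (ho : Odd p.length) : f t = f (p.getVert 1) := by
  obtain ⟨k, hk⟩ := ho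
  rw [← hp.apply_two_mul_add_one hf hk.ge, ← hk, p.getVert_length]

theorem apply_pred_of_odd (hp : IsThread H p) (hf : IsConstOnNeighbors G H f)
    (ho : Odd p.length) : f (p.getVert (p.length - 1)) = f s := by
  rw [← getVert_one_reverse]
  exact (hp.reverse.apply_end_of_odd hf (by simpa)).symm

theorem apply_end_of_even (hp : IsThread H p) (hf : IsConstOnNeighbors G H f)
    (he : Even p.length) : f t = f s := by
  obtain ⟨k, hk⟩ := even_iff_exists_two_mul.1 he
  rw [← hp.apply_two_mul hf hk.ge, ← hk, p.getVert_length]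

theorem apply_pred_of_even (hp : IsThread H p) (hf : IsConstOnNeighbors G H f)
    (he : Even p.length) : f (p.getVert (p.length - 1)) = f (p.getVert 1) := by
  have hpos := hp.pos
  obtain ⟨k, hk⟩ := even_iff_exists_two_mul.1 he
  rw [← hp.apply_two_mul_add_one hf (i := k - 1) (by omega)]
  congr 1
  congr 1
  omega

theorem apply_eq_of_odd (hp : IsThread H p) (hf : IsConstOnNeighbors G H f)
    (ho : Odd p.length) {x : V} (hx : x ∈ p.support) : f x = f s ∨ f x = f t := by
  obtain ⟨i, rfl, hi⟩ := Walk.mem_support_iff_exists_getVert.1 hx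
  obtain ⟨k, rfl | rfl⟩ := Nat.even_or_odd' i
  · exact Or.inl (hp.apply_two_mul hf hi)
  · exact Or.inr ((hp.apply_two_mul_add_one hf hi).trans (hp.apply_end_of_odd hf ho).symm)

end

theorem isSkewFort_of_even (hH : IsBranchCover G H) {p : G.Walk s s} (hp : IsThread H p)
    (he : Even p.length) :
    IsSkewFort G {x | ∃ i, 2 * i + 1 < p.length ∧ p.getVert (2 * i + 1) = x} := by
  set F := {x | ∃ i, 2 * i + 1 < p.length ∧ p.getVert (2 * i + 1) = x}
  have hlen := (hp.isCycle hH).three_le_length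
  obtain ⟨k, hk⟩ := even_iff_exists_two_mul.1 he
  have hpair (i : ℕ) (hi : i ≤ k) : ∃ a ∈ F, ∃ b ∈ F, a ≠ b ∧
      G.Adj (p.getVert (2 * i)) a ∧ G.Adj (p.getVert (2 * i)) b := by
    by_cases hends : i = 0 ∨ i = k
    · have hs : p.getVert (2 * i) = s := by
        rcases hends with rfl | rfl
        · exact p.getVert_zero
        · rw [← hk, p.getVert_length]
      rw [hs]
      exact ⟨p.getVert 1, ⟨0, by omega, rfl⟩, p.getVert (p.length - 1),
        ⟨k - 1, by omega, by congr 1; omega⟩, (hp.isCycle hH).snd_ne_penultimate, hp.adj_start,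
        hp.adj_end⟩
    · push Not at hends
      obtain ⟨j, rfl⟩ : ∃ j, i = j + 1 := ⟨i - 1, by omega⟩
      exact ⟨p.getVert (2 * j + 1), ⟨j, by omega, rfl⟩, p.getVert (2 * j + 1 + 2),
        ⟨j + 1, by omega, rfl⟩, hp.ne _ (by omega),
        (p.adj_getVert_succ (i := 2 * j + 1) (by omega)).symm,
        p.adj_getVert_succ (i := 2 * j + 2) (by omega)⟩
  refine ⟨⟨p.getVert 1, 0, by omega, rfl⟩, ?_⟩
  rintro u ⟨w, ⟨⟨i, hi, rfl⟩, huw⟩, huniq⟩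
  obtain ⟨j, hj, rfl⟩ : ∃ j ≤ k, u = p.getVert (2 * j) := by
    rcases hp.eq_of_adj_inner hH (i := 2 * i) (by omega) huw.symm with rfl | rfl
    · exact ⟨i, by omega, rfl⟩
    · exact ⟨i + 1, by omega, rfl⟩
  obtain ⟨a, ha, b, hb, hab, hua, hub⟩ := hpair j hj
  exact hab ((huniq a ⟨ha, hua⟩).trans (huniq b ⟨hb, hub⟩).symm)

/-- Consecutive edges of `p` share a vertex of degree two, so a common edge forces its first edge
to lie on `q`. -/
theorem mk_getVert_one_mem_edges_of_mem_edges (hH : IsBranchCover G H) (hp : IsThread H p) {a b : V}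
    {q : G.Walk a b} (hq : IsThread H q) {e : Sym2 V} (hep : e ∈ p.edges) (heq : e ∈ q.edges) :
    s(s, p.getVert 1) ∈ q.edges := by
  induction e with
  | _ x y =>
    obtain ⟨i, hi, hxy⟩ := (Walk.mk_mem_edges_iff_exists p).1 hep
    rw [← hxy] at heq
    clear hep hxy
    induction i with
    | zero => simpa using heq
    | succ i ih =>
      refine ih ?_ (by omega)
      rw [Sym2.eq_swap]
      exact hq.mem_edges_of_adj hH (q.fst_mem_support_of_mem_edges heq)
        (hp.notMem _ (by omega) hi) (p.adj_getVert_succ (by omega)).symm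

theorem support_eq_of_mem_edges (hH : IsBranchCover G H) (hp : IsThread H p) {a b : V}
    {q : G.Walk a b} (hq : IsThread H q) {e : Sym2 V} (hep : e ∈ p.edges) (heq : e ∈ q.edges) :
    (s = a ∧ t = b ∧ p.support = q.support) ∨
      (s = b ∧ t = a ∧ p.support = q.support.reverse) := by
  have hfirst := hp.mk_getVert_one_mem_edges_of_mem_edges hH hq hep heq
  rcases hq.eq_of_mem_edges hp.start_mem hfirst with ⟨rfl, h⟩ | ⟨rfl, h⟩
  · obtain rfl := hp.end_eq hH hq h
    exact Or.inl ⟨rfl, rfl, by rw [hp.eq_of_getVert_one hH hq h]⟩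
  · rw [← getVert_one_reverse] at h
    obtain rfl := hp.end_eq hH hq.reverse h
    exact Or.inr ⟨rfl, rfl, by rw [hp.eq_of_getVert_one hH hq.reverse h, Walk.support_reverse]⟩

theorem notMem_of_ne (hp : IsThread H p) {x : V} (hx : x ∈ p.support) (hs : x ≠ s)
    (ht : x ≠ t) : x ∉ H := by
  obtain ⟨i, rfl, hi⟩ := Walk.mem_support_iff_exists_getVert.1 hx
  refine hp.notMem i (Nat.pos_of_ne_zero ?_) (lt_of_le_of_ne hi ?_)
  · rintro rfl
    exact hs p.getVert_zero
  · rintro rfl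
    exact ht p.getVert_length

end IsThread

theorem IsSkewFort.isConstOnNeighbors {F : Set V} (hF : IsSkewFort G F)
    (hH : IsBranchCover G H) : IsConstOnNeighbors G H (· ∈ F) := by
  have hmem {x y z : V} (hx : x ∉ H) (hy : G.Adj x y) (hz : G.Adj x z) (hyF : y ∈ F) :
      z ∈ F := by
    by_cases hyz : y = z
    · exact hyz ▸ hyF
    obtain ⟨w, hw, hne, ha⟩ := hF.exists_ne_adj hyF hy
    exact (eq_or_eq_of_ncard_neighborSet_eq_two (hH x hx) hy hz hyz ha).resolve_left hne ▸ hw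
  exact fun x hx y z hy hz => propext ⟨hmem hx hy hz, hmem hx hz hy⟩

end ThreadParity

section UnivIsOnlySkewFort

variable {V : Type*} {G : SimpleGraph V}

/-- The vertex set is the one and only skew fort of `G`. -/
def UnivIsOnlySkewFort (G : SimpleGraph V) : Prop :=
  ∀ F, IsSkewFort G F ↔ F = Set.univ

theorem isSkewFort_univ [Nonempty V] (h : ∀ u, (G.neighborSet u).Nontrivial) :
    IsSkewFort G Set.univ := by
  refine ⟨Set.univ_nonempty, ?_⟩
  rintro u ⟨w, -, huniq⟩
  obtain ⟨a, ha, haw⟩ := (h u).exists_ne w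
  exact haw (huniq a ⟨Set.mem_univ a, ha⟩)

namespace UnivIsOnlySkewFort

theorem nontrivial_neighborSet [Nontrivial V] (h : UnivIsOnlySkewFort G) (x : V) :
    (G.neighborSet x).Nontrivial := by
  obtain ⟨a, ha⟩ : ∃ a, G.Adj x a := by
    by_contra! hiso
    have hx : IsSkewFort G {x} := by
      refine ⟨Set.singleton_nonempty x, ?_⟩
      rintro u ⟨_, ⟨rfl, hux⟩, -⟩
      exact hiso u hux.symm
    obtain ⟨y, hy⟩ := exists_ne x
    exact hy (((h _).1 hx).symm.subset (Set.mem_univ y))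
  obtain ⟨b, -, hne, hb⟩ := ((h Set.univ).2 rfl).exists_ne_adj (Set.mem_univ a) ha
  exact ⟨a, ha, b, hb, hne.symm⟩

theorem eq_univ_of_closed [Nontrivial V] (h : UnivIsOnlySkewFort G) {T : Set V}
    (hne : T.Nonempty) (hT : ∀ x ∈ T, ∀ y, G.Adj x y → y ∈ T) : T = Set.univ := by
  refine (h T).1 ⟨hne, ?_⟩
  rintro u ⟨w, ⟨hw, huw⟩, huniq⟩
  obtain ⟨a, ha, haw⟩ := (h.nontrivial_neighborSet u).exists_ne w
  exact haw (huniq a ⟨hT u (hT w hw u huw.symm) a ha, ha⟩)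

theorem odd_length {H : Set V} (h : UnivIsOnlySkewFort G) (hH : IsBranchCover G H) {s : V}
    {p : G.Walk s s} (hp : IsThread H p) : Odd p.length := by
  by_contra ho
  have huniv := (h _).1 (hp.isSkewFort_of_even hH (Nat.not_odd_iff_even.1 ho))
  obtain ⟨i, hi, his⟩ := huniv.symm.subset (Set.mem_univ s)
  rw [(hp.isCycle hH).getVert_endpoint_iff hi.le] at his
  omega

theorem exists_isThread_of_mem_edgeSet [Finite V] [Nontrivial V] {H : Set V}
    (h : UnivIsOnlySkewFort G) (hH : IsBranchCover G H) (hne : H.Nonempty) {e : Sym2 V}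
    (he : e ∈ G.edgeSet) : ∃ (s t : V) (p : G.Walk s t), IsThread H p ∧ e ∈ p.edges := by
  have hstart {a b : V} (ha : a ∈ H) (hab : G.Adj a b) :
      ∃ (s t : V) (p : G.Walk s t), IsThread H p ∧ s(a, b) ∈ p.edges := by
    obtain ⟨t, p, hp, h1⟩ := IsThread.exists_of_adj hH ha hab
    exact ⟨a, t, p, hp, h1 ▸ hp.mk_getVert_one_mem_edges⟩
  have hcover : {v | v ∈ H ∨ ∃ (s t : V) (p : G.Walk s t), IsThread H p ∧ v ∈ p.support} =
      Set.univ := by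
    refine h.eq_univ_of_closed (hne.mono fun _ => Or.inl) fun a ha b hab => Or.inr ?_
    obtain ⟨s, t, p, hp, hep⟩ :
        ∃ (s t : V) (p : G.Walk s t), IsThread H p ∧ s(a, b) ∈ p.edges := by
      by_cases haH : a ∈ H
      · exact hstart haH hab
      · obtain ⟨s, t, p, hp, hap⟩ := ha.resolve_left haH
        exact ⟨s, t, p, hp, hp.mem_edges_of_adj hH hap haH hab⟩
    exact ⟨s, t, p, hp, p.snd_mem_support_of_mem_edges hep⟩
  induction e with
  | _ x y =>
    by_cases hxH : x ∈ H
    · exact hstart hxH he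
    · obtain ⟨s, t, p, hp, hxp⟩ := (hcover.symm.subset (Set.mem_univ x)).resolve_left hxH
      exact ⟨s, t, p, hp, hp.mem_edges_of_adj hH hxp hxH he⟩

theorem skewZeroForcingSpan_eq_zero [Fintype V] [DecidableEq V] (h : UnivIsOnlySkewFort G) :
    skewZeroForcingSpan G = 0 := by
  refine skewZeroForcingSpan_eq_zero_iff.2 (Or.inr ⟨Fintype.card V, le_rfl, fun S hS => ?_,
    fun S hS => ?_⟩)
  · rw [h, (Finset.card_eq_iff_eq_univ S).1 hS, Finset.coe_univ]
  · rw [h, Finset.coe_eq_univ] at hS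
    rw [hS, Finset.card_univ]

end UnivIsOnlySkewFort

theorem HasUniformSkewForts.univIsOnlySkewFort [Fintype V]
    (h : HasUniformSkewForts G (Fintype.card V)) : UnivIsOnlySkewFort G := by
  classical
  refine fun F => ⟨fun hF => ?_, ?_⟩
  · have hcard := h.le_of_isSkewFort F.toFinset (by simpa using hF)
    rwa [(Finset.card_le_univ _).ge_iff_eq', eq_comm, Finset.card_eq_iff_eq_univ,
      Set.toFinset_eq_univ] at hcard
  · rintro rfl
    simpa using h.isSkewFort Finset.univ Finset.card_univ

end UnivIsOnlySkewFort

section OddlyThreaded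

variable {V : Type*} {G : SimpleGraph V} {H : Set V}

/-- The graph is made up of threads of odd length between the vertices of `H`, which contains all
branch vertices. -/
structure IsOddlyThreaded (G : SimpleGraph V) (H : Set V) : Prop where
  isBranchCover : IsBranchCover G H
  odd_length : ∀ {s t : V} {p : G.Walk s t}, IsThread H p → Odd p.length
  exists_isThread : ∀ e ∈ G.edgeSet, ∃ (s t : V) (p : G.Walk s t), IsThread H p ∧ e ∈ p.edges

namespace IsOddlyThreaded

theorem exists_isThread_of_adj (h : IsOddlyThreaded G H) {s x : V} (hs : s ∈ H)
    (hsx : G.Adj s x) : ∃ (t : V) (p : G.Walk s t), IsThread H p ∧ p.getVert 1 = x := by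
  obtain ⟨a, b, p, hp, he⟩ := h.exists_isThread s(s, x) hsx
  rcases hp.eq_of_mem_edges hs he with ⟨rfl, rfl⟩ | ⟨rfl, rfl⟩
  · exact ⟨b, p, hp, rfl⟩
  · exact ⟨a, p.reverse, hp.reverse, IsThread.getVert_one_reverse⟩

theorem exists_apply_eq (h : IsOddlyThreaded G H) {α : Type*} {f : V → α}
    (hf : IsConstOnNeighbors G H f) (x : V) : ∃ s ∈ H, f x = f s := by
  by_cases hx : x ∈ H
  · exact ⟨x, hx, rfl⟩
  obtain ⟨y, hy⟩ := (h.isBranchCover.nontrivial_neighborSet hx).nonempty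
  obtain ⟨s, t, p, hp, he⟩ := h.exists_isThread s(x, y) hy
  rcases hp.apply_eq_of_odd hf (h.odd_length hp) (p.fst_mem_support_of_mem_edges he) with hs | ht
  · exact ⟨s, hp.start_mem, hs⟩
  · exact ⟨t, hp.end_mem, ht⟩

theorem exists_isThread_of_end_mem (h : IsOddlyThreaded G H) {F : Set V} (hF : IsSkewFort G F)
    {s t : V} {p : G.Walk s t} (hp : IsThread H p) (ht : t ∈ F) :
    ∃ t' ∈ F, ∃ q : G.Walk s t', IsThread H q ∧ q.getVert 1 ≠ p.getVert 1 := by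
  have hend {r : V} {q : G.Walk s r} (hq : IsThread H q) : (r ∈ F) = (q.getVert 1 ∈ F) :=
    hq.apply_end_of_odd (hF.isConstOnNeighbors h.isBranchCover) (h.odd_length hq)
  obtain ⟨y, hyF, hne, hy⟩ := hF.exists_ne_adj ((hend hp).mp ht) hp.adj_start
  obtain ⟨t', q, hq, rfl⟩ := h.exists_isThread_of_adj hp.start_mem hy
  exact ⟨t', (hend hq).mpr hyF, q, hq, hne⟩

theorem univIsOnlySkewFort [Nonempty V] (h : IsOddlyThreaded G H)
    (hnt : ∀ s ∈ H, (G.neighborSet s).Nontrivial)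
    (hmem : ∀ F, IsSkewFort G F → ∀ s ∈ H, ∀ t ∈ H, s ∈ F → t ∈ F) : UnivIsOnlySkewFort G := by
  refine fun F => ⟨fun hF => ?_, ?_⟩
  · have hf := hF.isConstOnNeighbors h.isBranchCover
    obtain ⟨x, hx⟩ := hF.1
    obtain ⟨s, hs, hxs⟩ := h.exists_apply_eq hf x
    refine Set.eq_univ_of_forall fun y => ?_
    obtain ⟨t, ht, hyt⟩ := h.exists_apply_eq hf y
    exact hyt.mpr (hmem F hF s hs t ht (hxs.mp hx))
  · rintro rfl
    refine isSkewFort_univ fun u => ?_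
    by_cases hu : u ∈ H
    · exact hnt u hu
    · exact h.isBranchCover.nontrivial_neighborSet hu

end IsOddlyThreaded

theorem UnivIsOnlySkewFort.isOddlyThreaded_of_odd [Finite V] [Nontrivial V]
    (h : UnivIsOnlySkewFort G) (hH : IsBranchCover G H) (hne : H.Nonempty)
    (hodd : ∀ {s t : V} {p : G.Walk s t}, s ≠ t → IsThread H p → Odd p.length) :
    IsOddlyThreaded G H where
  isBranchCover := hH
  odd_length {s t p} hp := by
    by_cases hst : s = t
    · subst hst
      exact h.odd_length hH hp
    · exact hodd hst hp
  exists_isThread _ he := h.exists_isThread_of_mem_edgeSet hH hne he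

namespace IsThread

variable {s t : V} {p : G.Walk s t}

theorem mem_or_reverse_mem {W : ∀ a b : V, Set (G.Walk a b)} (hH : IsBranchCover G H)
    (hW : ∀ a b, ∀ q ∈ W a b, IsThread H q)
    (hedge : ∀ e ∈ G.edgeSet, ∃ a b, ∃ q ∈ W a b, e ∈ q.edges) (hp : IsThread H p) :
    p ∈ W s t ∨ p.reverse ∈ W t s := by
  obtain ⟨a, b, q, hq, he⟩ := hedge s(s, p.getVert 1) hp.adj_start
  rcases hp.support_eq_of_mem_edges hH (hW a b q hq) hp.mk_getVert_one_mem_edges he with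
    ⟨rfl, rfl, h⟩ | ⟨rfl, rfl, h⟩
  · exact Or.inl (Walk.ext_support h ▸ hq)
  · rw [← Walk.support_reverse] at h
    exact Or.inr (by rwa [Walk.ext_support h, Walk.reverse_reverse])

theorem nontrivial_neighborSet (hH : IsBranchCover G H) {p : G.Walk s s} (hp : IsThread H p) :
    (G.neighborSet s).Nontrivial :=
  ⟨_, hp.adj_start, _, hp.adj_end, (hp.isCycle hH).snd_ne_penultimate⟩

theorem nontrivial_neighborSet_of_ne (hH : IsBranchCover G H) (hp : IsThread H p) {t' : V}
    {q : G.Walk s t'} (hq : IsThread H q) (hne : t ≠ t') : (G.neighborSet s).Nontrivial :=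
  ⟨_, hp.adj_start, _, hq.adj_start, mt (hp.end_eq hH hq) hne⟩

end IsThread

theorem IsOddlyThreaded.of_walks {W : ∀ a b : V, Set (G.Walk a b)} (hH : IsBranchCover G H)
    (hW : ∀ a b, ∀ q ∈ W a b, IsThread H q ∧ Odd q.length)
    (hedge : ∀ e ∈ G.edgeSet, ∃ a b, ∃ q ∈ W a b, e ∈ q.edges) : IsOddlyThreaded G H where
  isBranchCover := hH
  odd_length {s t p} hp := by
    rcases hp.mem_or_reverse_mem hH (fun a b q hq => (hW a b q hq).1) hedge with h | h
    · exact (hW s t p h).2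
    · simpa using (hW t s p.reverse h).2
  exists_isThread e he := by
    obtain ⟨a, b, q, hq, heq⟩ := hedge e he
    exact ⟨a, b, q, (hW a b q hq).1, heq⟩

section Bouquet

variable {c : V}

theorem IsOddCycleBouquet.exists_isOddlyThreaded (h : IsOddCycleBouquet G) :
    ∃ c, IsOddlyThreaded G {c} ∧ ∃ p : G.Walk c c, IsThread {c} p := by
  obtain ⟨c, C, ⟨p₀, hp₀⟩, hcyc, hdisj, hcov, hedge⟩ := h
  have hthread (p) (hp : p ∈ C) : IsThread {c} p :=
    .of_isCycle (hcyc p hp).1 (Set.mem_singleton c) fun _ _ => id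
  have hH : IsBranchCover G {c} := by
    intro x hx
    obtain ⟨p, hp, hxp⟩ := hcov x
    have hN : G.neighborSet x = p.toSubgraph.neighborSet x := by
      refine Set.Subset.antisymm (fun y hy => ?_) (p.toSubgraph.neighborSet_subset x)
      obtain ⟨q, hq, he⟩ := hedge s(x, y) hy
      obtain rfl : p = q := by
        by_contra hne
        exact hx ((hdisj p hp q hq hne).subset ⟨hxp, q.fst_mem_support_of_mem_edges he⟩)
      exact p.adj_toSubgraph_iff_mem_edges.2 he
    rw [hN, (hcyc p hp).1.ncard_neighborSet_toSubgraph_eq_two hxp]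
  refine ⟨c, .of_walks (W := fun a b => {p | a = c ∧ b = c ∧ ∃ q ∈ C, p.support = q.support}) hH
    ?_ fun e he => ?_, p₀, hthread p₀ hp₀⟩
  · rintro _ _ p ⟨rfl, rfl, q, hq, hpq⟩
    obtain rfl := Walk.ext_support hpq
    exact ⟨hthread p hq, (hcyc p hq).2⟩
  · obtain ⟨p, hp, he⟩ := hedge e he
    exact ⟨c, c, p, ⟨rfl, rfl, p, hp, rfl⟩, he⟩

theorem IsThread.setOf_mem_support_eq (hH : IsBranchCover G H) {s t a b : V} {p : G.Walk s t}
    {q : G.Walk a b} (hp : IsThread H p) (hq : IsThread H q) {x : V} (hx : x ∉ H)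
    (hxp : x ∈ p.support) (hxq : x ∈ q.support) :
    {y | y ∈ p.support} = {y | y ∈ q.support} := by
  obtain ⟨y, hy⟩ := (hH.nontrivial_neighborSet hx).nonempty
  rcases hp.support_eq_of_mem_edges hH hq (hp.mem_edges_of_adj hH hxp hx hy)
    (hq.mem_edges_of_adj hH hxq hx hy) with ⟨-, -, h⟩ | ⟨-, -, h⟩ <;> simp [h]

/-- Every cycle is traversed by two threads, of which the bouquet contains one. -/
theorem IsOddlyThreaded.isOddCycleBouquet (h : IsOddlyThreaded G {c})
    (hc : ∃ p : G.Walk c c, IsThread {c} p) : IsOddCycleBouquet G := by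
  have hH := h.isBranchCover
  obtain ⟨C, hCT, hC⟩ := Set.exists_subset_bijOn {p : G.Walk c c | IsThread {c} p}
    fun p => {x | x ∈ p.support}
  have hedge (e) (he : e ∈ G.edgeSet) : ∃ p ∈ C, e ∈ p.edges := by
    obtain ⟨s, t, p, hp, hep⟩ := h.exists_isThread e he
    obtain rfl : c = s := hp.start_mem.symm
    obtain rfl : c = t := hp.end_mem.symm
    obtain ⟨q, hq, hqp⟩ := hC.surjOn ⟨p, hp, rfl⟩
    refine ⟨q, hq, ?_⟩
    obtain ⟨x, y, rfl, hx⟩ : ∃ x y, e = s(x, y) ∧ x ≠ c := by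
      induction e with
      | _ x y =>
        by_cases hx : x = c
        · exact ⟨y, x, Sym2.eq_swap, fun hy => G.ne_of_adj he (hx.trans hy.symm)⟩
        · exact ⟨x, y, rfl, hx⟩
    exact (hCT hq).mem_edges_of_adj hH (hqp.superset (p.fst_mem_support_of_mem_edges hep)) hx he
  obtain ⟨p₀, hp₀⟩ := hc
  obtain ⟨q₀, hq₀, -⟩ := hC.surjOn ⟨p₀, hp₀, rfl⟩
  refine ⟨c, C, ⟨q₀, hq₀⟩, fun p hp => ⟨(hCT hp).isCycle hH, h.odd_length (hCT hp)⟩,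
    fun p hp q hq hpq => ?_, fun x => ?_, hedge⟩
  · refine Set.eq_singleton_iff_unique_mem.2 ⟨⟨p.start_mem_support, q.start_mem_support⟩, ?_⟩
    rintro x ⟨hxp, hxq⟩
    by_contra hx
    exact hpq (hC.injOn hp hq ((hCT hp).setOf_mem_support_eq hH (hCT hq) hx hxp hxq))
  · by_cases hx : x = c
    · exact ⟨q₀, hq₀, hx ▸ q₀.start_mem_support⟩
    · obtain ⟨y, hy⟩ := (hH.nontrivial_neighborSet hx).nonempty
      obtain ⟨p, hp, he⟩ := hedge s(x, y) hy
      exact ⟨p, hp, p.fst_mem_support_of_mem_edges he⟩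

theorem IsOddCycleBouquet.univIsOnlySkewFort (h : IsOddCycleBouquet G) :
    UnivIsOnlySkewFort G := by
  obtain ⟨c, hc, p, hp⟩ := h.exists_isOddlyThreaded
  have : Nonempty V := ⟨c⟩
  refine hc.univIsOnlySkewFort ?_ ?_
  · rintro _ rfl
    exact hp.nontrivial_neighborSet hc.isBranchCover
  · rintro F - _ rfl _ rfl
    exact id

end Bouquet

end OddlyThreaded

section Dipole

variable {V : Type*} {G : SimpleGraph V} {m : ℕ} {s : Fin (2 * m + 1 + 1) → V}

/-- The vertices `s 0, …, s (2m+1)` show `G` to be a doubly extended bouquet-dipole, the cycles and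
paths being described as the threads over the range of `s`. -/
structure IsDipoleLayout (G : SimpleGraph V) {m : ℕ} (s : Fin (2 * m + 1 + 1) → V) : Prop where
  injective : Function.Injective s
  isOddlyThreaded : IsOddlyThreaded G (Set.range s)
  exists_loop_zero : ∃ p : G.Walk (s 0) (s 0), IsThread (Set.range s) p
  exists_loop_last :
    ∃ p : G.Walk (s (Fin.last (2 * m + 1))) (s (Fin.last (2 * m + 1))), IsThread (Set.range s) p
  existsUnique_of_even : ∀ j : Fin (2 * m + 1), Even (j : ℕ) →
    ∃! p : G.Walk (s j.castSucc) (s j.succ), IsThread (Set.range s) p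
  nontrivial_of_odd : ∀ j : Fin (2 * m + 1), Odd (j : ℕ) →
    {p : G.Walk (s j.castSucc) (s j.succ) | IsThread (Set.range s) p}.Nontrivial
  eq_or_eq_succ : ∀ {i k : Fin (2 * m + 1 + 1)} {p : G.Walk (s i) (s k)},
    IsThread (Set.range s) p →
    (i = 0 ∧ k = 0) ∨ (i = Fin.last (2 * m + 1) ∧ k = Fin.last (2 * m + 1)) ∨
      (∃ j : Fin (2 * m + 1), i = j.castSucc ∧ k = j.succ) ∨
      ∃ j : Fin (2 * m + 1), i = j.succ ∧ k = j.castSucc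

/-- The walks from `a` to `b` among the cycles and paths `C`, `D` and `P` that make up a doubly
extended bouquet-dipole. A walk is compared with those by its support, as the ends of the latter
are only propositionally equal to `a` and `b`. -/
def dipoleWalks (C : Set (G.Walk (s 0) (s 0)))
    (D : Set (G.Walk (s (Fin.last (2 * m + 1))) (s (Fin.last (2 * m + 1)))))
    (P : ∀ j : Fin (2 * m + 1), Set (G.Walk (s j.castSucc) (s j.succ))) (a b : V) :
    Set (G.Walk a b) :=
  {p | (a = s 0 ∧ b = s 0 ∧ ∃ c ∈ C, p.support = c.support) ∨
    (a = s (Fin.last _) ∧ b = s (Fin.last _) ∧ ∃ d ∈ D, p.support = d.support) ∨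
    ∃ j, a = s j.castSucc ∧ b = s j.succ ∧ ∃ q ∈ P j, p.support = q.support}

theorem IsDipoleLayout.of_dipoleWalks {C : Set (G.Walk (s 0) (s 0))}
    {D : Set (G.Walk (s (Fin.last (2 * m + 1))) (s (Fin.last (2 * m + 1))))}
    {P : ∀ j : Fin (2 * m + 1), Set (G.Walk (s j.castSucc) (s j.succ))}
    (hs : Function.Injective s) (hH : IsBranchCover G (Set.range s)) (hC : C.Nonempty)
    (hD : D.Nonempty)
    (hW : ∀ a b, ∀ p ∈ dipoleWalks C D P a b, IsThread (Set.range s) p ∧ Odd p.length)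
    (heven : ∀ j : Fin (2 * m + 1), Even (j : ℕ) → ∃ p, P j = {p})
    (hodd : ∀ j : Fin (2 * m + 1), Odd (j : ℕ) → (P j).Nontrivial)
    (hedge : ∀ e ∈ G.edgeSet, ∃ a b, ∃ p ∈ dipoleWalks C D P a b, e ∈ p.edges) :
    IsDipoleLayout G s := by
  have hP (j p) (hp : p ∈ P j) : IsThread (Set.range s) p :=
    (hW _ _ p (Or.inr (Or.inr ⟨j, rfl, rfl, p, hp, rfl⟩))).1
  have hmem {a b : V} {p : G.Walk a b} (hp : IsThread (Set.range s) p) :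
      p ∈ dipoleWalks C D P a b ∨ p.reverse ∈ dipoleWalks C D P b a :=
    hp.mem_or_reverse_mem hH (fun a b q hq => (hW a b q hq).1) hedge
  refine ⟨hs, .of_walks hH hW hedge, hC.imp fun c hc => ?_, hD.imp fun d hd => ?_,
    fun j hj => ?_, fun j hj => (hodd j hj).mono (hP j), fun {i k p} hp => ?_⟩
  · exact (hW _ _ c (Or.inl ⟨rfl, rfl, c, hc, rfl⟩)).1
  · exact (hW _ _ d (Or.inr (Or.inl ⟨rfl, rfl, d, hd, rfl⟩))).1
  · obtain ⟨p, hp⟩ := heven j hj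
    refine ⟨p, hP j p (hp ▸ Set.mem_singleton p), fun q hq => ?_⟩
    rcases hmem hq with (⟨-, h1, -⟩ | ⟨h0, -, -⟩ | ⟨k, h0, -, r, hr, hqr⟩) |
      (⟨h0, -, -⟩ | ⟨-, h1, -⟩ | ⟨k, h0, h1, -⟩)
    · exact absurd (hs h1) (Fin.succ_ne_zero j)
    · exact absurd (hs h0) (Fin.castSucc_lt_last j).ne
    · obtain rfl := Fin.castSucc_injective _ (hs h0)
      rw [hp] at hr
      exact (Walk.ext_support hqr).trans hr
    · exact absurd (hs h0) (Fin.succ_ne_zero j)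
    · exact absurd (hs h1) (Fin.castSucc_lt_last j).ne
    · have h0 := congrArg Fin.val (hs h0)
      have h1 := congrArg Fin.val (hs h1)
      simp only [Fin.val_succ, Fin.val_castSucc] at h0 h1
      omega
  · rcases hmem hp with (⟨h0, h1, -⟩ | ⟨h0, h1, -⟩ | ⟨j, h0, h1, -⟩) |
      (⟨h0, h1, -⟩ | ⟨h0, h1, -⟩ | ⟨j, h0, h1, -⟩) <;> have h0 := hs h0 <;> have h1 := hs h1
    · exact Or.inl ⟨h0, h1⟩
    · exact Or.inr (Or.inl ⟨h0, h1⟩)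
    · exact Or.inr (Or.inr (Or.inl ⟨j, h0, h1⟩))
    · exact Or.inl ⟨h1, h0⟩
    · exact Or.inr (Or.inl ⟨h1, h0⟩)
    · exact Or.inr (Or.inr (Or.inr ⟨j, h1, h0⟩))

theorem IsDoublyExtendedBouquetDipole.exists_isDipoleLayout
    (h : IsDoublyExtendedBouquetDipole G) :
    ∃ (m : ℕ) (s : Fin (2 * m + 1 + 1) → V), IsDipoleLayout G s := by
  obtain ⟨m, s, C, D, P, hs, hCne, hDne, hC, hD, hP, heven, hodd, hcov, hedge⟩ := h
  have hH : IsBranchCover G (Set.range s) := by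
    intro x hx
    have hne (i) : x ≠ s i := fun h => hx ⟨i, h.symm⟩
    rcases hcov x with ⟨c, hc, hxc⟩ | ⟨d, hd, hxd⟩ | ⟨j, p, hp, hxp⟩
    · exact ((hC c hc).2.2 x hxc (hne _)).2
    · exact ((hD d hd).2.2 x hxd (hne _)).2
    · exact ((hP j p hp).2.2 x hxp (hne _) (hne _)).2
  refine ⟨m, s, .of_dipoleWalks hs hH hCne hDne ?_ heven hodd fun e he => ?_⟩
  · rintro _ _ p (⟨rfl, rfl, q, hq, hpq⟩ | ⟨rfl, rfl, q, hq, hpq⟩ | ⟨j, rfl, rfl, q, hq, hpq⟩) <;>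
      obtain rfl := Walk.ext_support hpq
    · exact ⟨.of_isCycle (hC p hq).1 ⟨_, rfl⟩ fun x hx hne => ((hC p hq).2.2 x hx hne).1,
        (hC p hq).2.1⟩
    · exact ⟨.of_isCycle (hD p hq).1 ⟨_, rfl⟩ fun x hx hne => ((hD p hq).2.2 x hx hne).1,
        (hD p hq).2.1⟩
    · exact ⟨.of_isPath (hP j p hq).1 (hs.ne Fin.castSucc_lt_succ.ne) ⟨_, rfl⟩ ⟨_, rfl⟩
        fun x hx h1 h2 => ((hP j p hq).2.2 x hx h1 h2).1, (hP j p hq).2.1⟩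
  · rcases hedge e he with ⟨c, hc, he⟩ | ⟨d, hd, he⟩ | ⟨j, p, hp, he⟩
    · exact ⟨_, _, c, Or.inl ⟨rfl, rfl, c, hc, rfl⟩, he⟩
    · exact ⟨_, _, d, Or.inr (Or.inl ⟨rfl, rfl, d, hd, rfl⟩), he⟩
    · exact ⟨_, _, p, Or.inr (Or.inr ⟨j, rfl, rfl, p, hp, rfl⟩), he⟩

theorem forall_of_alternating_steps {b : ℕ → Prop} {m : ℕ}
    (hdown : ∀ k ≤ m, b (2 * k + 1) → b (2 * k - 1))
    (hup : ∀ k ≤ m, b (2 * k) → b (min (2 * k + 2) (2 * m + 1))) {j : ℕ} (hj : j < 2 * m + 2)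
    (hbj : b j) {i : ℕ} (hi : i < 2 * m + 2) : b i := by
  have hup_of_lt (k) (hk : k < m) : b (2 * k) → b (2 * (k + 1)) := by
    simpa only [mul_add, min_eq_left (show 2 * k + 2 ≤ 2 * m + 1 by omega)] using hup k hk.le
  have hbot (k) (hk : k ≤ m) (h : b (2 * k + 1)) : b 0 := by
    induction k with
    | zero => exact hdown 0 hk h
    | succ k ih => exact ih (by omega) (hdown (k + 1) hk h)
  have htop (k) (hk : k ≤ m) (h : b (2 * k)) : b (2 * m + 1) := by
    induction hk using Nat.decreasingInduction with
    | self => simpa using hup m le_rfl h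
    | of_succ k hk ih => exact ih (hup_of_lt k hk h)
  have hlast : b (2 * m + 1) := by
    obtain ⟨k, rfl | rfl⟩ := Nat.even_or_odd' j
    · exact htop k (by omega) hbj
    · exact htop 0 m.zero_le (hbot k (by omega) hbj)
  obtain ⟨k, rfl | rfl⟩ := Nat.even_or_odd' i
  · induction k with
    | zero => exact hbot m le_rfl hlast
    | succ k ih => exact hup_of_lt k (by omega) (ih (by omega))
  · have hk : k ≤ m := by omega
    induction hk using Nat.decreasingInduction with
    | self => exact hlast
    | of_succ k hk ih => exact hdown (k + 1) hk (ih (by omega))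

namespace IsDipoleLayout

theorem exists_isThread (h : IsDipoleLayout G s) (j : Fin (2 * m + 1)) :
    ∃ p : G.Walk (s j.castSucc) (s j.succ), IsThread (Set.range s) p := by
  rcases Nat.even_or_odd (j : ℕ) with hj | hj
  · exact (h.existsUnique_of_even j hj).exists
  · exact (h.nontrivial_of_odd j hj).nonempty

theorem nontrivial_neighborSet (h : IsDipoleLayout G s) (i : Fin (2 * m + 1 + 1)) :
    (G.neighborSet (s i)).Nontrivial := by
  have hH := h.isOddlyThreaded.isBranchCover
  rcases Fin.eq_zero_or_eq_succ i with rfl | ⟨j, rfl⟩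
  · exact h.exists_loop_zero.choose_spec.nontrivial_neighborSet hH
  rcases Fin.eq_castSucc_or_eq_last j.succ with ⟨k, hjk⟩ | hj
  · obtain ⟨p, hp⟩ := h.exists_isThread j
    obtain ⟨q, hq⟩ : ∃ q : G.Walk (s j.succ) (s k.succ), IsThread (Set.range s) q :=
      hjk ▸ h.exists_isThread k
    refine hp.reverse.nontrivial_neighborSet_of_ne hH hq (h.injective.ne fun hne => ?_)
    simp only [Fin.ext_iff, Fin.val_succ, Fin.val_castSucc] at hjk hne
    omega
  · rw [hj]
    exact h.exists_loop_last.choose_spec.nontrivial_neighborSet hH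

section

variable {F : Set V} {j : Fin (2 * m + 1)}

theorem exists_mem_of_castSucc_mem (h : IsDipoleLayout G s) (hF : IsSkewFort G F)
    (hj : Even (j : ℕ)) (hjF : s j.castSucc ∈ F) :
    ∃ k : Fin (2 * m + 1 + 1), (k : ℕ) = min ((j : ℕ) + 2) (2 * m + 1) ∧ s k ∈ F := by
  obtain ⟨p, hp, huniq⟩ := h.existsUnique_of_even j hj
  obtain ⟨_, hkF, q, hq, hne⟩ := h.isOddlyThreaded.exists_isThread_of_end_mem hF hp.reverse hjF
  obtain ⟨k, rfl⟩ := hq.end_mem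
  rcases h.eq_or_eq_succ hq with ⟨h0, -⟩ | ⟨hl, rfl⟩ | ⟨l, hl, rfl⟩ | ⟨l, hl, rfl⟩
  · exact absurd h0 (Fin.succ_ne_zero j)
  · refine ⟨_, ?_, hkF⟩
    simp only [Fin.ext_iff, Fin.val_succ, Fin.val_last] at hl ⊢
    omega
  · refine ⟨_, ?_, hkF⟩
    simp only [Fin.ext_iff, Fin.val_succ, Fin.val_castSucc] at hl ⊢
    omega
  · obtain rfl := Fin.succ_injective _ hl
    exact absurd (by rw [← huniq _ hq.reverse, Walk.reverse_reverse]) hne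

theorem exists_mem_of_succ_mem (h : IsDipoleLayout G s) (hF : IsSkewFort G F)
    (hj : Even (j : ℕ)) (hjF : s j.succ ∈ F) :
    ∃ k : Fin (2 * m + 1 + 1), (k : ℕ) = j - 1 ∧ s k ∈ F := by
  obtain ⟨p, hp, huniq⟩ := h.existsUnique_of_even j hj
  obtain ⟨_, hkF, q, hq, hne⟩ := h.isOddlyThreaded.exists_isThread_of_end_mem hF hp hjF
  obtain ⟨k, rfl⟩ := hq.end_mem
  rcases h.eq_or_eq_succ hq with ⟨h0, rfl⟩ | ⟨hl, -⟩ | ⟨l, hl, rfl⟩ | ⟨l, hl, rfl⟩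
  · refine ⟨_, ?_, hkF⟩
    simp only [Fin.ext_iff, Fin.val_castSucc, Fin.val_zero] at h0 ⊢
    omega
  · exact absurd hl (Fin.castSucc_lt_last j).ne
  · obtain rfl := Fin.castSucc_injective _ hl
    exact absurd (by rw [huniq q hq]) hne
  · refine ⟨_, ?_, hkF⟩
    simp only [Fin.ext_iff, Fin.val_succ, Fin.val_castSucc] at hl ⊢
    omega

end

theorem univIsOnlySkewFort (h : IsDipoleLayout G s) : UnivIsOnlySkewFort G := by
  have : Nonempty V := ⟨s 0⟩
  refine h.isOddlyThreaded.univIsOnlySkewFort ?_ ?_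
  · rintro _ ⟨i, rfl⟩
    exact h.nontrivial_neighborSet i
  rintro F hF _ ⟨i, rfl⟩ _ ⟨k, rfl⟩ hi
  obtain ⟨k', hk', hk'F⟩ : ∃ k' : Fin (2 * m + 1 + 1), (k' : ℕ) = k ∧ s k' ∈ F := by
    refine forall_of_alternating_steps (m := m)
      (b := fun n => ∃ k : Fin (2 * m + 1 + 1), (k : ℕ) = n ∧ s k ∈ F) ?_ ?_ i.2 ⟨i, rfl, hi⟩ k.2
    · rintro l hl ⟨k, hk, hkF⟩
      have hl' : 2 * l < 2 * m + 1 := by omega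
      obtain rfl : k = Fin.succ ⟨2 * l, hl'⟩ := Fin.ext hk
      exact h.exists_mem_of_succ_mem hF (even_two_mul l) hkF
    · rintro l hl ⟨k, hk, hkF⟩
      have hl' : 2 * l < 2 * m + 1 := by omega
      obtain rfl : k = Fin.castSucc ⟨2 * l, hl'⟩ := Fin.ext hk
      exact h.exists_mem_of_castSucc_mem hF (even_two_mul l) hkF
  rwa [← Fin.ext hk']

theorem isDoublyExtendedBouquetDipole (h : IsDipoleLayout G s) :
    IsDoublyExtendedBouquetDipole G := by
  have hH := h.isOddlyThreaded.isBranchCover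
  have hout {x : V} (hx : x ∉ Set.range s) : x ∉ Set.range s ∧ (G.neighborSet x).ncard = 2 :=
    ⟨hx, hH x hx⟩
  have hedge (e) (he : e ∈ G.edgeSet) :
      (∃ c ∈ {c : G.Walk (s 0) (s 0) | IsThread (Set.range s) c}, e ∈ c.edges) ∨
      (∃ d ∈ {d : G.Walk (s (Fin.last _)) (s (Fin.last _)) | IsThread (Set.range s) d},
        e ∈ d.edges) ∨
      ∃ j : Fin (2 * m + 1),
        ∃ p ∈ {p : G.Walk (s j.castSucc) (s j.succ) | IsThread (Set.range s) p},
        e ∈ p.edges := by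
    obtain ⟨_, _, p, hp, he⟩ := h.isOddlyThreaded.exists_isThread e he
    obtain ⟨i, rfl⟩ := hp.start_mem
    obtain ⟨k, rfl⟩ := hp.end_mem
    rcases h.eq_or_eq_succ hp with ⟨rfl, rfl⟩ | ⟨rfl, rfl⟩ | ⟨j, rfl, rfl⟩ | ⟨j, rfl, rfl⟩
    · exact Or.inl ⟨p, hp, he⟩
    · exact Or.inr (Or.inl ⟨p, hp, he⟩)
    · exact Or.inr (Or.inr ⟨j, p, hp, he⟩)
    · exact Or.inr (Or.inr ⟨j, p.reverse, hp.reverse, by simpa using he⟩)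
  refine ⟨m, s, _, _, _, h.injective, h.exists_loop_zero, h.exists_loop_last,
    fun c hc => ⟨hc.isCycle hH, h.isOddlyThreaded.odd_length hc,
      fun x hx hne => hout (hc.notMem_of_ne hx hne hne)⟩,
    fun d hd => ⟨hd.isCycle hH, h.isOddlyThreaded.odd_length hd,
      fun x hx hne => hout (hd.notMem_of_ne hx hne hne)⟩,
    fun j p hp => ⟨hp.isPath hH (h.injective.ne Fin.castSucc_lt_succ.ne),
      h.isOddlyThreaded.odd_length hp, fun x hx h0 h1 => hout (hp.notMem_of_ne hx h0 h1)⟩,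
    fun j hj => ?_, h.nontrivial_of_odd, fun x => ?_, hedge⟩
  · obtain ⟨p, hp, huniq⟩ := h.existsUnique_of_even j hj
    exact ⟨p, Set.eq_singleton_iff_unique_mem.2 ⟨hp, huniq⟩⟩
  · obtain ⟨y, hy⟩ : (G.neighborSet x).Nonempty := by
      by_cases hx : x ∈ Set.range s
      · obtain ⟨i, rfl⟩ := hx
        exact (h.nontrivial_neighborSet i).nonempty
      · exact (hH.nontrivial_neighborSet hx).nonempty
    exact (hedge s(x, y) hy).imp
      (fun ⟨c, hc, he⟩ => ⟨c, hc, c.fst_mem_support_of_mem_edges he⟩)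
      (Or.imp (fun ⟨d, hd, he⟩ => ⟨d, hd, d.fst_mem_support_of_mem_edges he⟩)
        fun ⟨j, p, hp, he⟩ => ⟨j, p, hp, p.fst_mem_support_of_mem_edges he⟩)

end IsDipoleLayout

theorem IsDoublyExtendedBouquetDipole.univIsOnlySkewFort (h : IsDoublyExtendedBouquetDipole G) :
    UnivIsOnlySkewFort G := by
  obtain ⟨m, s, hs⟩ := h.exists_isDipoleLayout
  exact hs.univIsOnlySkewFort

end Dipole

section AlternatingInvolutions

variable {H : Type*} {r t : Equiv.Perm H}

theorem left_apply_mul_zpow (hr : Function.Involutive r) (ht : Function.Involutive t) (j : ℤ)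
    (h : H) : r (((r * t) ^ j) h) = ((r * t) ^ (-j)) (r h) := by
  have hconj : SemiconjBy r (r * t) (r * t)⁻¹ := by
    rw [SemiconjBy, eq_inv_mul_iff_mul_eq]
    ext h
    simp only [Equiv.Perm.mul_apply, hr _, ht _]
  rw [zpow_neg, ← inv_zpow, ← Equiv.Perm.mul_apply, hconj.zpow_right j, Equiv.Perm.mul_apply]

theorem right_apply_mul_zpow (hr : Function.Involutive r) (ht : Function.Involutive t) (j : ℤ)
    (h : H) : t (((r * t) ^ j) h) = ((r * t) ^ (-(j + 1))) (r h) := by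
  rw [← left_apply_mul_zpow hr ht, add_comm, zpow_add, zpow_one, Equiv.Perm.mul_apply,
    Equiv.Perm.mul_apply, hr]

/-- If `(r * t) ^ c` takes `h` to `r h`, then the element halfway between them is fixed by `r` or
by `t`, according to the parity of `c`. -/
theorem exists_apply_eq_self_of_sameCycle (hr : Function.Involutive r)
    (ht : Function.Involutive t) (hfix : ∀ h, t h ≠ h) {h : H}
    (hcyc : (r * t).SameCycle h (r h)) : ∃ b, r b = b := by
  obtain ⟨c, hc⟩ := hcyc
  obtain ⟨k, rfl | rfl⟩ := Int.even_or_odd' c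
  · refine ⟨((r * t) ^ k) h, ?_⟩
    rw [left_apply_mul_zpow hr ht, ← hc, ← Equiv.Perm.mul_apply, ← zpow_add]
    congr 2
    ring
  · refine absurd ?_ (hfix (((r * t) ^ k) h))
    rw [right_apply_mul_zpow hr ht, ← hc, ← Equiv.Perm.mul_apply, ← zpow_add]
    congr 2
    ring

theorem even_card_of_involutive [Fintype H] (ht : Function.Involutive t) (hfix : ∀ h, t h ≠ h) :
    Even (Fintype.card H) := by
  classical
  have hsupp : t.support = Finset.univ := by
    ext h
    simp only [Equiv.Perm.mem_support, hfix h, ne_eq, not_false_iff, Finset.mem_univ]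
  have hsq : t ^ 2 = 1 := by
    ext h
    rw [sq, Equiv.Perm.mul_apply, ht, Equiv.Perm.one_apply]
  rw [even_iff_two_dvd, ← Finset.card_univ, ← hsupp]
  exact Equiv.Perm.two_dvd_card_support hsq

theorem abs_intEquivNat_symm_sub_lt {n i j : ℕ} (hi : i < 2 * n) (hj : j < 2 * n) :
    |Equiv.intEquivNat.symm i - Equiv.intEquivNat.symm j| < 2 * n := by
  have hmem {i : ℕ} (hi : i < 2 * n) :
      -(n : ℤ) ≤ Equiv.intEquivNat.symm i ∧ Equiv.intEquivNat.symm i < n := by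
    obtain ⟨k, rfl | rfl⟩ := Nat.even_or_odd' i
    · have : Equiv.intEquivNat.symm (2 * k) = k := by rw [Equiv.symm_apply_eq]; rfl
      omega
    · have : Equiv.intEquivNat.symm (2 * k + 1) = Int.negSucc k := by
        rw [Equiv.symm_apply_eq]; rfl
      omega
  have := hmem hi
  have := hmem hj
  grind

/-- Listing the integers as `0, -1, 1, -2, 2, …` turns the two reflections `j ↦ -j` and
`j ↦ -(j + 1)` into steps between neighbors. -/
theorem exists_alternating_enumeration [Finite H] [Nonempty H] (hr : Function.Involutive r)
    (ht : Function.Involutive t) (hfix : ∀ h, t h ≠ h) (hcyc : ∀ x y, (r * t).SameCycle x y) :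
    ∃ (m : ℕ) (s : Fin (2 * m + 1 + 1) → H), Function.Bijective s ∧ r (s 0) = s 0 ∧
      r (s (Fin.last (2 * m + 1))) = s (Fin.last (2 * m + 1)) ∧
      (∀ j : Fin (2 * m + 1), Even (j : ℕ) → t (s j.castSucc) = s j.succ) ∧
      ∀ j : Fin (2 * m + 1), Odd (j : ℕ) → r (s j.castSucc) = s j.succ := by
  have := Fintype.ofFinite H
  have hon : (r * t).IsCycleOn (Finset.univ : Finset H) :=
    ⟨by simpa only [Finset.coe_univ] using (r * t).bijective.bijOn_univ, fun x _ y _ => hcyc x y⟩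
  have hper (b : H) (i j : ℤ) :
      ((r * t) ^ i) b = ((r * t) ^ j) b ↔ i ≡ j [ZMOD Fintype.card H] := by
    rw [hon.zpow_apply_eq_zpow_apply (Finset.mem_univ b), Finset.card_univ]
  obtain ⟨m, hm⟩ : ∃ m, Fintype.card H = 2 * (m + 1) := by
    obtain ⟨k, hk⟩ := even_card_of_involutive ht hfix
    have := Fintype.card_pos (α := H)
    exact ⟨k - 1, by omega⟩
  obtain ⟨b, hb⟩ := exists_apply_eq_self_of_sameCycle hr ht hfix (hcyc (Classical.arbitrary H) _)
  let e (j : ℕ) : H := ((r * t) ^ Equiv.intEquivNat.symm j) b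
  have heven (k : ℕ) : Equiv.intEquivNat.symm (2 * k) = k := by rw [Equiv.symm_apply_eq]; rfl
  have hodd (k : ℕ) : Equiv.intEquivNat.symm (2 * k + 1) = -(k + 1) := by
    rw [Equiv.symm_apply_eq, ← Int.negSucc_eq]; rfl
  have hzero : r (e 0) = e 0 := hb
  have hlast : r (e (2 * m + 1)) = e (2 * m + 1) := by
    rw [left_apply_mul_zpow hr ht, hb, hper, hodd, hm, Int.modEq_iff_dvd]
    exact ⟨-1, by push_cast; ring⟩
  have ht_step (k : ℕ) : t (e (k + k)) = e (k + k + 1) := by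
    simp only [e, ← two_mul, right_apply_mul_zpow hr ht, hb, heven, hodd]
  have hr_step (k : ℕ) : r (e (2 * k + 1)) = e (2 * (k + 1)) := by
    simp only [e, left_apply_mul_zpow hr ht, hb, heven, hodd, neg_neg, Nat.cast_succ]
  refine ⟨m, fun j => e j,
    (Fintype.bijective_iff_injective_and_card _).2 ⟨fun i j hij => ?_, ?_⟩, ?_, hlast, ?_, ?_⟩
  · have hdvd := ((hper b _ _).1 hij).symm.dvd
    rw [hm] at hdvd
    have habs := abs_intEquivNat_symm_sub_lt (n := m + 1) i.2 j.2
    have := Int.eq_zero_of_abs_lt_dvd hdvd (by exact_mod_cast habs)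
    exact Fin.ext (Equiv.intEquivNat.symm.injective (sub_eq_zero.1 this))
  · rw [Fintype.card_fin, hm]; ring
  · rwa [← Fin.val_zero (2 * m + 1)] at hzero
  · rintro ⟨j, hj⟩ ⟨k, rfl : j = k + k⟩
    exact ht_step k
  · rintro ⟨j, hj⟩ ⟨k, rfl : j = 2 * k + 1⟩
    exact hr_step k

end AlternatingInvolutions

section LinkClasses

theorem card_le_card_quot_add {α ι : Type*} [Finite α] [Finite ι] {r : α → α → Prop} (a b : ι → α)
    (hr : ∀ y z, r y z → y ≠ z → ∃ i, s(a i, b i) = s(y, z)) :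
    Nat.card α ≤ Nat.card (Quot r) + Nat.card ι := by
  have := Fintype.ofFinite α
  have := Fintype.ofFinite ι
  have := Fintype.ofFinite (Quot r)
  let Φ : (α → ℚ) →ₗ[ℚ] (ι → ℚ) := LinearMap.funLeft ℚ ℚ a - LinearMap.funLeft ℚ ℚ b
  let Ψ : (Quot r → ℚ) →ₗ[ℚ] (α → ℚ) := LinearMap.funLeft ℚ ℚ (Quot.mk r)
  have hker : LinearMap.ker Φ ≤ LinearMap.range Ψ := by
    intro f hf
    have hab (i : ι) : f (a i) = f (b i) := sub_eq_zero.1 (congrFun (LinearMap.mem_ker.1 hf) i)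
    refine ⟨Quot.lift f fun y z hyz => ?_, rfl⟩
    by_cases hne : y = z
    · rw [hne]
    · obtain ⟨i, hi⟩ := hr y z hyz hne
      grind
  have hrank := LinearMap.finrank_range_add_finrank_ker Φ
  have hrange := Submodule.finrank_le (LinearMap.range Φ)
  have hker' := (Submodule.finrank_mono hker).trans (LinearMap.finrank_range_le Ψ)
  simp only [Module.finrank_fintype_fun_eq_card, ← Nat.card_eq_fintype_card] at hrank hrange hker'
  omega

theorem nontrivial_sdiff_singleton {α : Type*} {S : Set α} (hS : S.Nontrivial)
    (h2 : S.ncard ≠ 2) (a : α) : (S \ {a}).Nontrivial := by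
  by_contra! hsub
  obtain ⟨b, hb, hba⟩ := hS.exists_ne a
  obtain ⟨c, hc, hcb⟩ := hS.exists_ne b
  have hle (x) (hx : x ∈ S) : x = a ∨ x = b := or_iff_not_imp_left.2 fun hxa =>
    hsub ⟨hx, hxa⟩ ⟨hb, hba⟩
  obtain rfl : c = a := (hle c hc).resolve_right hcb
  refine h2 (Set.ncard_eq_two.2 ⟨c, b, hcb, Set.Subset.antisymm hle ?_⟩)
  rintro _ (rfl | rfl) <;> assumption

variable {V : Type*} {G : SimpleGraph V} {H : Set V}

/-- The classes of vertices under the equivalence relation in which any two neighbors of a vertex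
outside `H` are equivalent. -/
def LinkClass (G : SimpleGraph V) (H : Set V) : Type _ :=
  Quot fun y z : V => ∃ x ∉ H, G.Adj x y ∧ G.Adj x z

/-- The link class of a vertex. -/
def linkClass (G : SimpleGraph V) (H : Set V) (x : V) : LinkClass G H :=
  Quot.mk _ x

theorem linkClass_surjective : Function.Surjective (linkClass G H) :=
  Quot.mk_surjective

instance [Finite V] : Finite (LinkClass G H) :=
  Finite.of_surjective _ linkClass_surjective

theorem isConstOnNeighbors_linkClass : IsConstOnNeighbors G H (linkClass G H) :=
  fun x hx _ _ hy hz => Quot.sound ⟨x, hx, hy, hz⟩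

theorem IsBranchCover.card_le_card_linkClass [Finite V] (hH : IsBranchCover G H) :
    Nat.card H ≤ Nat.card (LinkClass G H) := by
  choose a b _ hab using fun x : (Hᶜ : Set V) => Set.ncard_eq_two.1 (hH x x.2)
  have hquot : Nat.card V ≤ Nat.card (LinkClass G H) + Nat.card (Hᶜ : Set V) := by
    refine card_le_card_quot_add a b ?_
    rintro y z ⟨x, hx, hy, hz⟩ hyz
    refine ⟨⟨x, hx⟩, ?_⟩
    have hmem {w : V} (hw : G.Adj x w) : w = a ⟨x, hx⟩ ∨ w = b ⟨x, hx⟩ :=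
      (hab ⟨x, hx⟩).subset hw
    have := hmem hy
    have := hmem hz
    grind
  have := Set.ncard_add_ncard_compl H
  rw [← Nat.card_coe_set_eq, ← Nat.card_coe_set_eq] at this
  omega

/-- `w` is the only neighbor of `u` whose link class is not in `T`. -/
structure IsSoleExit (G : SimpleGraph V) (H : Set V) (T : Set (LinkClass G H)) (u w : V) :
    Prop where
  adj : G.Adj u w
  notMem : linkClass G H w ∉ T
  mem_of_ne : ∀ y, G.Adj u y → y ≠ w → linkClass G H y ∈ T

theorem IsSoleExit.inter_nonempty {T T' : Set (LinkClass G H)} {u w w' : V}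
    (hu : (G.neighborSet u \ {w}).Nontrivial) (h : IsSoleExit G H T u w)
    (h' : IsSoleExit G H T' u w') : (T ∩ T').Nonempty := by
  obtain ⟨y, ⟨hy, hyw⟩, hyw'⟩ := hu.exists_ne w'
  exact ⟨linkClass G H y, h.mem_of_ne y hy hyw, h'.mem_of_ne y hy hyw'⟩

theorem UnivIsOnlySkewFort.exists_isSoleExit [Nontrivial V] (h : UnivIsOnlySkewFort G)
    {T : Set (LinkClass G H)} (hT : T.Nonempty) (hTu : T ≠ Set.univ) :
    ∃ u ∈ H, ∃ w, IsSoleExit G H T u w := by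
  have hfort : ¬ IsSkewFort G {x | linkClass G H x ∉ T} := by
    rw [h, Set.eq_univ_iff_forall]
    obtain ⟨q, hq⟩ := hT
    obtain ⟨x, rfl⟩ := linkClass_surjective q
    exact fun hall => hall x hq
  have hne : {x | linkClass G H x ∉ T}.Nonempty := by
    obtain ⟨q, hq⟩ := (Set.ne_univ_iff_exists_notMem T).1 hTu
    obtain ⟨x, rfl⟩ := linkClass_surjective q
    exact ⟨x, hq⟩
  simp only [IsSkewFort, hne, true_and, not_forall, not_not] at hfort
  obtain ⟨u, w, ⟨hw, huw⟩, huniq⟩ := hfort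
  have hexit (y) (hy : G.Adj u y) (hyw : y ≠ w) : linkClass G H y ∈ T :=
    not_not.1 fun hyT => hyw (huniq y ⟨hyT, hy⟩)
  refine ⟨u, not_not.1 fun hu => ?_, w, huw, hw, hexit⟩
  obtain ⟨y, hy, hyw⟩ := (h.nontrivial_neighborSet u).exists_ne w
  exact hw (isConstOnNeighbors_linkClass u hu y w hy huw ▸ hexit y hy hyw)

/-- A bijection `cls` from `H` to the link classes such that all neighbors of `h` but one, `thin h`,
are in the class `cls h`, and no proper nonempty set of link classes is closed under the passage
from `cls h` to the class of `thin h`. The neighbors other than `thin h` are called fat; there are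
at least two of them. -/
structure ThinEdges (G : SimpleGraph V) (H : Set V) where
  cls : H ≃ LinkClass G H
  thin : H → V
  isSoleExit_thin : ∀ h, IsSoleExit G H {cls h} h (thin h)
  nontrivial_fat : ∀ h : H, (G.neighborSet h \ {thin h}).Nontrivial
  eq_univ_of_closed : ∀ T : Set (LinkClass G H), T.Nonempty →
    (∀ h, cls h ∈ T → linkClass G H (thin h) ∈ T) → T = Set.univ

theorem UnivIsOnlySkewFort.exists_equiv_isSoleExit [Finite V] [Nontrivial V]
    [Nontrivial (LinkClass G H)] (h : UnivIsOnlySkewFort G) (hH : IsBranchCover G H)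
    (hdeg : ∀ u ∈ H, ∀ w, (G.neighborSet u \ {w}).Nontrivial) :
    ∃ e : LinkClass G H ≃ H, ∀ q, ∃ w, IsSoleExit G H {q} (e q) w := by
  have hexit (q : LinkClass G H) : ∃ u : H, ∃ w, IsSoleExit G H {q} u w := by
    obtain ⟨u, hu, hw⟩ := h.exists_isSoleExit (Set.singleton_nonempty q)
      (Set.singleton_ne_univ q)
    exact ⟨⟨u, hu⟩, hw⟩
  choose u w hw using hexit
  have hinj : Function.Injective u := by
    intro q q' hqq
    obtain ⟨_, rfl, rfl⟩ := (hw q).inter_nonempty (hdeg _ (u q).2 _) (hqq ▸ hw q')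
    rfl
  exact ⟨Equiv.ofBijective u (hinj.bijective_of_nat_card_le hH.card_le_card_linkClass),
    fun q => ⟨w q, hw q⟩⟩

theorem UnivIsOnlySkewFort.nonempty_thinEdges [Finite V] [Nontrivial V]
    [Nontrivial (LinkClass G H)] (h : UnivIsOnlySkewFort G) (hH : IsBranchCover G H)
    (hdeg : ∀ u ∈ H, ∀ w, (G.neighborSet u \ {w}).Nontrivial) : Nonempty (ThinEdges G H) := by
  obtain ⟨e, he⟩ := h.exists_equiv_isSoleExit hH hdeg
  choose thin hthin using fun h : H => e.apply_symm_apply h ▸ he (e.symm h)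
  refine ⟨e.symm, thin, hthin, fun h => hdeg h h.2 _, fun T hT hclosed => not_not.1 fun hTu => ?_⟩
  obtain ⟨u, hu, w, hw⟩ := h.exists_isSoleExit hT hTu
  obtain ⟨_, hmem, rfl⟩ := hw.inter_nonempty (hdeg u hu w) (hthin ⟨u, hu⟩)
  by_cases hwt : w = thin ⟨u, hu⟩
  · exact hw.notMem (hwt ▸ hclosed _ hmem)
  · exact hw.notMem ((hthin ⟨u, hu⟩).mem_of_ne w hw.adj hwt ▸ hmem)

end LinkClasses

section ThinEdges

variable {V : Type*} {G : SimpleGraph V} {H : Set V} {s t : H} {p : G.Walk s t}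

theorem IsBranchCover.exists_isThread_of_adj [Finite V] (hH : IsBranchCover G H) {x : V}
    (hsx : G.Adj s x) : ∃ (t : H) (p : G.Walk s t), IsThread H p ∧ p.getVert 1 = x := by
  obtain ⟨t, p, hp, h1⟩ := IsThread.exists_of_adj hH s.2 hsx
  exact ⟨⟨t, hp.end_mem⟩, p, hp, h1⟩

namespace ThinEdges

variable (E : ThinEdges G H)

theorem linkClass_eq_cls {x : V} (hx : G.Adj s x) (hne : x ≠ E.thin s) :
    linkClass G H x = E.cls s :=
  (E.isSoleExit_thin s).mem_of_ne x hx hne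

theorem linkClass_thin_ne (h : H) : linkClass G H (E.thin h) ≠ E.cls h :=
  (E.isSoleExit_thin h).notMem

theorem bijective_linkClass_thin [Finite V] :
    Function.Bijective fun h => linkClass G H (E.thin h) := by
  rcases isEmpty_or_nonempty H with hH | ⟨⟨h₀⟩⟩
  · have := E.cls.symm.isEmpty
    exact ⟨Function.injective_of_subsingleton _, fun q => isEmptyElim q⟩
  have hsurj : Function.Surjective fun h => linkClass G H (E.thin h) :=
    Set.range_eq_univ.1 <|
      E.eq_univ_of_closed (Set.range _) ⟨_, h₀, rfl⟩ fun h _ => ⟨h, rfl⟩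
  exact hsurj.bijective_of_nat_card_le (Nat.card_congr E.cls).le

include E in
theorem injective_linkClass_of_surjective [Finite V]
    (hs : Function.Surjective fun h : H => linkClass G H h) :
    Function.Injective fun h : H => linkClass G H h :=
  (hs.bijective_of_nat_card_le (Nat.card_congr E.cls).le).injective

theorem pred_eq_thin_of_even (h : UnivIsOnlySkewFort G) (hH : IsBranchCover G H)
    (hp : IsThread H p) (he : Even p.length) (h1 : p.getVert 1 ≠ E.thin s) :
    p.getVert (p.length - 1) = E.thin t := by
  by_contra hpred
  have hcls : E.cls t = E.cls s := by
    rw [← E.linkClass_eq_cls hp.adj_end hpred, ← E.linkClass_eq_cls hp.adj_start h1]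
    exact hp.apply_pred_of_even isConstOnNeighbors_linkClass he
  obtain rfl := E.cls.injective hcls
  exact Nat.not_even_iff_odd.2 (h.odd_length hH hp) he

include E in
theorem surjective_linkClass [Finite V] (h : UnivIsOnlySkewFort G) (hH : IsBranchCover G H) :
    Function.Surjective fun h : H => linkClass G H h := by
  refine E.cls.surjective.forall.2 fun s => ?_
  by_contra! hno
  have hfat (x : V) (hx : x ∈ G.neighborSet s \ {E.thin s}) :
      ∃ (t : H) (p : G.Walk s t), IsThread H p ∧ p.getVert 1 = x ∧
        p.getVert (p.length - 1) = E.thin t ∧ linkClass G H (E.thin t) = E.cls s := by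
    obtain ⟨t, p, hp, rfl⟩ := hH.exists_isThread_of_adj hx.1
    have hcls := E.linkClass_eq_cls hp.adj_start hx.2
    have he : Even p.length := Nat.not_odd_iff_even.1 fun ho =>
      hno t ((hp.apply_end_of_odd isConstOnNeighbors_linkClass ho).trans hcls)
    have hpred := E.pred_eq_thin_of_even h hH hp he hx.2
    refine ⟨t, p, hp, rfl, hpred, ?_⟩
    rw [← hpred, hp.apply_pred_of_even isConstOnNeighbors_linkClass he, hcls]
  obtain ⟨x, hx, y, hy, hxy⟩ := E.nontrivial_fat s
  obtain ⟨t, p, hp, rfl, hpt, hts⟩ := hfat x hx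
  obtain ⟨t', q, hq, rfl, hqt, hts'⟩ := hfat y hy
  obtain rfl := E.bijective_linkClass_thin.injective (hts.trans hts'.symm)
  exact hxy (by rw [hp.eq_of_getVert_pred hH hq (hpt.trans hqt.symm)])

include E in
theorem isOddlyThreaded [Finite V] [Nontrivial V] (h : UnivIsOnlySkewFort G)
    (hH : IsBranchCover G H) : IsOddlyThreaded G H := by
  obtain ⟨x, -⟩ := exists_pair_ne V
  refine h.isOddlyThreaded_of_odd hH ⟨_, (E.cls.symm (linkClass G H x)).2⟩ fun hst hp => ?_
  by_contra ho
  have hts := hp.apply_end_of_even isConstOnNeighbors_linkClass (Nat.not_odd_iff_even.1 ho)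
  have hinj := E.injective_linkClass_of_surjective (E.surjective_linkClass h hH)
  exact hst.symm (congrArg Subtype.val (@hinj ⟨_, hp.end_mem⟩ ⟨_, hp.start_mem⟩ hts))

/-- In an oddly threaded graph with thin edges, every link class contains exactly one vertex of
`H`. -/
noncomputable def linkEquiv [Finite V] (hO : IsOddlyThreaded G H) : H ≃ LinkClass G H :=
  have hs : Function.Surjective fun h : H => linkClass G H h :=
    linkClass_surjective.forall.2 fun x =>
      have ⟨s, hs, hxs⟩ := hO.exists_apply_eq isConstOnNeighbors_linkClass x
      ⟨⟨s, hs⟩, hxs.symm⟩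
  .ofBijective _ ⟨E.injective_linkClass_of_surjective hs, hs⟩

/-- The common end of the threads that leave `h` through its fat neighbors. -/
noncomputable def fatEnd [Finite V] (hO : IsOddlyThreaded G H) : Equiv.Perm H :=
  E.cls.trans (E.linkEquiv hO).symm

/-- The end of the thread that leaves `h` through `thin h`. -/
noncomputable def thinEnd [Finite V] (hO : IsOddlyThreaded G H) : Equiv.Perm H :=
  (Equiv.ofBijective _ E.bijective_linkClass_thin).trans (E.linkEquiv hO).symm

variable [Finite V] (hO : IsOddlyThreaded G H)

theorem linkClass_fatEnd (h : H) : linkClass G H (E.fatEnd hO h) = E.cls h :=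
  (E.linkEquiv hO).apply_symm_apply _

theorem linkClass_thinEnd (h : H) :
    linkClass G H (E.thinEnd hO h) = linkClass G H (E.thin h) :=
  (E.linkEquiv hO).apply_symm_apply _

theorem end_eq_fatEnd (hp : IsThread H p) (h1 : p.getVert 1 ≠ E.thin s) :
    t = E.fatEnd hO s := by
  refine (E.linkEquiv hO).injective (Eq.trans ?_ (E.linkClass_fatEnd hO s).symm)
  rw [← E.linkClass_eq_cls hp.adj_start h1]
  exact hp.apply_end_of_odd isConstOnNeighbors_linkClass (hO.odd_length hp)

theorem end_eq_thinEnd (hp : IsThread H p) (h1 : p.getVert 1 = E.thin s) :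
    t = E.thinEnd hO s := by
  refine (E.linkEquiv hO).injective (Eq.trans ?_ (E.linkClass_thinEnd hO s).symm)
  rw [← h1]
  exact hp.apply_end_of_odd isConstOnNeighbors_linkClass (hO.odd_length hp)

theorem fatEnd_ne_thinEnd (h : H) : E.fatEnd hO h ≠ E.thinEnd hO h := fun heq =>
  E.linkClass_thin_ne h (by rw [← E.linkClass_thinEnd hO, ← heq, E.linkClass_fatEnd])

include hO in
omit [Finite V] in
theorem pred_eq_thin_of_ne (hp : IsThread H p) (hne : E.cls t ≠ linkClass G H s) :
    p.getVert (p.length - 1) = E.thin t := by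
  by_contra hpred
  refine hne ((E.linkClass_eq_cls hp.adj_end hpred).symm.trans ?_)
  exact hp.apply_pred_of_odd isConstOnNeighbors_linkClass (hO.odd_length hp)

theorem exists_isThread_fatEnd {h : H} {x : V} (hx : x ∈ G.neighborSet h \ {E.thin h}) :
    ∃ p : G.Walk h (E.fatEnd hO h), IsThread H p ∧ p.getVert 1 = x := by
  obtain ⟨t, p, hp, rfl⟩ := hO.isBranchCover.exists_isThread_of_adj hx.1
  obtain rfl := E.end_eq_fatEnd hO hp hx.2
  exact ⟨p, hp, rfl⟩

theorem exists_isThread_thinEnd (h : H) :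
    ∃ p : G.Walk h (E.thinEnd hO h), IsThread H p ∧ p.getVert 1 = E.thin h := by
  obtain ⟨t, p, hp, h1⟩ := hO.isBranchCover.exists_isThread_of_adj (E.isSoleExit_thin h).adj
  obtain rfl := E.end_eq_thinEnd hO hp h1
  exact ⟨p, hp, h1⟩

theorem nontrivial_isThread_fatEnd (h : H) :
    {p : G.Walk h (E.fatEnd hO h) | IsThread H p}.Nontrivial := by
  obtain ⟨x, hx, y, hy, hxy⟩ := E.nontrivial_fat h
  obtain ⟨p, hp, rfl⟩ := E.exists_isThread_fatEnd hO hx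
  obtain ⟨q, hq, rfl⟩ := E.exists_isThread_fatEnd hO hy
  exact ⟨p, hp, q, hq, fun hpq => hxy (by rw [hpq])⟩

theorem existsUnique_isThread_thinEnd (h : H) :
    ∃! p : G.Walk h (E.thinEnd hO h), IsThread H p := by
  obtain ⟨p, hp, h1⟩ := E.exists_isThread_thinEnd hO h
  refine ⟨p, hp, fun q hq => hq.eq_of_getVert_one hO.isBranchCover hp ?_⟩
  by_contra hne
  exact E.fatEnd_ne_thinEnd hO h (E.end_eq_fatEnd hO hq (h1 ▸ hne)).symm

theorem cls_fatEnd (h : H) : E.cls (E.fatEnd hO h) = linkClass G H h := by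
  by_contra hne
  obtain ⟨p, hp, q, hq, hpq⟩ := E.nontrivial_isThread_fatEnd hO h
  exact hpq (hp.eq_of_getVert_pred hO.isBranchCover hq
    ((E.pred_eq_thin_of_ne hO hp hne).trans (E.pred_eq_thin_of_ne hO hq hne).symm))

theorem fatEnd_involutive : Function.Involutive (E.fatEnd hO) := fun h =>
  (E.linkEquiv hO).injective ((E.linkClass_fatEnd hO _).trans (E.cls_fatEnd hO h))

theorem pred_eq_thin {h : H} {p : G.Walk h (E.thinEnd hO h)} (hp : IsThread H p) :
    p.getVert (p.length - 1) = E.thin (E.thinEnd hO h) := by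
  refine E.pred_eq_thin_of_ne hO hp fun hcls => E.fatEnd_ne_thinEnd hO h ?_
  rw [← E.cls_fatEnd hO] at hcls
  exact (E.cls.injective hcls).symm

theorem thinEnd_involutive : Function.Involutive (E.thinEnd hO) := by
  refine fun h => (E.linkEquiv hO).injective ((E.linkClass_thinEnd hO _).trans ?_)
  obtain ⟨p, hp, -⟩ := E.exists_isThread_thinEnd hO h
  rw [← E.pred_eq_thin hO hp]
  exact hp.apply_pred_of_odd isConstOnNeighbors_linkClass (hO.odd_length hp)

theorem thinEnd_ne (h : H) : E.thinEnd hO h ≠ h := fun heq => by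
  obtain ⟨p, hp, h1⟩ := E.exists_isThread_thinEnd hO h
  have hpred := E.pred_eq_thin hO hp
  generalize E.thinEnd hO h = t at p heq
  subst heq
  exact (hp.isCycle hO.isBranchCover).snd_ne_penultimate (h1.trans hpred.symm)

theorem sameCycle_fatEnd_mul_thinEnd (x y : H) :
    (E.fatEnd hO * E.thinEnd hO).SameCycle x y := by
  have horbit := E.eq_univ_of_closed
    {q | (E.fatEnd hO * E.thinEnd hO).SameCycle x (E.cls.symm q)}
    ⟨E.cls x, by simp [Equiv.Perm.SameCycle.rfl]⟩ fun h hh => ?_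
  · simpa using horbit.symm.subset (Set.mem_univ (E.cls y))
  · rw [Set.mem_ofPred_eq, E.cls.symm_apply_apply] at hh
    rw [Set.mem_ofPred_eq, ← E.linkClass_thinEnd hO, ← E.cls_fatEnd hO, E.cls.symm_apply_apply]
    exact hh.apply_right

end ThinEdges

end ThinEdges

section Classification

variable {V : Type*} {G : SimpleGraph V}

section Enumeration

variable {α : Type*} {f : α → α} {m : ℕ} {s : Fin (2 * m + 1 + 1) → α}
  {i k : Fin (2 * m + 1 + 1)}

theorem eq_succ_of_apply_eq_of_even (hf : Function.Involutive f) (hs : Function.Injective s)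
    (heven : ∀ j : Fin (2 * m + 1), Even (j : ℕ) → f (s j.castSucc) = s j.succ)
    (h : s k = f (s i)) :
    (∃ j : Fin (2 * m + 1), i = j.castSucc ∧ k = j.succ) ∨
      ∃ j : Fin (2 * m + 1), i = j.succ ∧ k = j.castSucc := by
  rcases Nat.even_or_odd (i : ℕ) with hi | hi
  · obtain ⟨j, rfl⟩ := Fin.exists_castSucc_eq.2 (show i ≠ Fin.last (2 * m + 1) by
      rintro rfl
      exact Nat.not_even_two_mul_add_one m hi)
    exact Or.inl ⟨j, rfl, hs (h.trans (heven j hi))⟩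
  · obtain ⟨j, rfl⟩ := Fin.exists_succ_eq.2 (show i ≠ 0 by
      rintro rfl
      exact Nat.not_odd_zero hi)
    rw [Fin.val_succ, Nat.odd_add_one, Nat.not_odd_iff_even] at hi
    exact Or.inr ⟨j, rfl, hs (h.trans (hf.eq_iff.2 (heven j hi).symm))⟩

theorem eq_succ_of_apply_eq_of_odd (hf : Function.Involutive f) (hs : Function.Injective s)
    (h0 : f (s 0) = s 0) (hlast : f (s (Fin.last (2 * m + 1))) = s (Fin.last (2 * m + 1)))
    (hodd : ∀ j : Fin (2 * m + 1), Odd (j : ℕ) → f (s j.castSucc) = s j.succ)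
    (h : s k = f (s i)) :
    (i = 0 ∧ k = 0) ∨ (i = Fin.last (2 * m + 1) ∧ k = Fin.last (2 * m + 1)) ∨
      (∃ j : Fin (2 * m + 1), i = j.castSucc ∧ k = j.succ) ∨
      ∃ j : Fin (2 * m + 1), i = j.succ ∧ k = j.castSucc := by
  by_cases hi0 : i = 0
  · subst hi0
    exact Or.inl ⟨rfl, hs (h.trans h0)⟩
  by_cases hil : i = Fin.last (2 * m + 1)
  · subst hil
    exact Or.inr (Or.inl ⟨rfl, hs (h.trans hlast)⟩)
  refine Or.inr (Or.inr ?_)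
  rcases Nat.even_or_odd (i : ℕ) with hi | hi
  · obtain ⟨j, rfl⟩ := Fin.exists_succ_eq.2 hi0
    rw [Fin.val_succ, Nat.even_add_one, Nat.not_even_iff_odd] at hi
    exact Or.inr ⟨j, rfl, hs (h.trans (hf.eq_iff.2 (hodd j hi).symm))⟩
  · obtain ⟨j, rfl⟩ := Fin.exists_castSucc_eq.2 hil
    exact Or.inl ⟨j, rfl, hs (h.trans (hodd j hi))⟩

end Enumeration

theorem ThinEdges.exists_isDipoleLayout [Finite V] {H : Set V} [Nonempty H] (E : ThinEdges G H)
    (hO : IsOddlyThreaded G H) : ∃ (m : ℕ) (s : Fin (2 * m + 1 + 1) → V), IsDipoleLayout G s := by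
  obtain ⟨m, s, hs, h0, hlast, heven, hodd⟩ := exists_alternating_enumeration
    (E.fatEnd_involutive hO) (E.thinEnd_involutive hO) (E.thinEnd_ne hO)
    (E.sameCycle_fatEnd_mul_thinEnd hO)
  have hrange : Set.range (fun j => (s j : V)) = H :=
    (hs.surjective.range_comp _).trans Subtype.range_coe
  have hfat {h h' : H} (hh : E.fatEnd hO h = h') : {p : G.Walk h h' | IsThread H p}.Nontrivial :=
    hh ▸ E.nontrivial_isThread_fatEnd hO h
  refine ⟨m, fun j => s j, Subtype.val_injective.comp hs.injective, ?_, ?_, ?_, fun j hj => ?_,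
    fun j hj => ?_, fun {i k p} hp => ?_⟩
  · rwa [hrange]
  · rw [hrange]
    exact (hfat h0).nonempty
  · rw [hrange]
    exact (hfat hlast).nonempty
  · rw [hrange]
    exact heven j hj ▸ E.existsUnique_isThread_thinEnd hO _
  · rw [hrange]
    exact hfat (hodd j hj)
  · rw [hrange] at hp
    by_cases h1 : p.getVert 1 = E.thin (s i)
    · exact Or.inr <| Or.inr <| eq_succ_of_apply_eq_of_even (E.thinEnd_involutive hO) hs.injective
        heven (E.end_eq_thinEnd hO hp h1)
    · exact eq_succ_of_apply_eq_of_odd (E.fatEnd_involutive hO) hs.injective h0 hlast hodd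
        (E.end_eq_fatEnd hO hp h1)

namespace UnivIsOnlySkewFort

variable [Finite V] [Nontrivial V] {H : Set V}

theorem isOddCycleBouquet (h : UnivIsOnlySkewFort G) {c : V} (hH : IsBranchCover G {c}) :
    IsOddCycleBouquet G := by
  refine IsOddlyThreaded.isOddCycleBouquet (h.isOddlyThreaded_of_odd hH
    (Set.singleton_nonempty c) fun hst hp => absurd (hp.start_mem.trans hp.end_mem.symm) hst) ?_
  obtain ⟨x, hx⟩ := (h.nontrivial_neighborSet c).nonempty
  obtain ⟨t, p, hp, -⟩ := IsThread.exists_of_adj hH (Set.mem_singleton c) hx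
  obtain rfl : t = c := hp.end_mem
  exact ⟨p, hp⟩

theorem isOddCycleBouquet_of_subsingleton (h : UnivIsOnlySkewFort G) (hH : IsBranchCover G H)
    [Subsingleton (LinkClass G H)] : IsOddCycleBouquet G := by
  have hcard : Nat.card H ≤ 1 :=
    hH.card_le_card_linkClass.trans (Finite.card_le_one_iff_subsingleton.2 inferInstance)
  have hsub : H.Subsingleton := Set.ncard_le_one_iff_subsingleton.1 hcard
  obtain ⟨x, -⟩ := exists_pair_ne V
  obtain rfl | ⟨c, rfl⟩ := hsub.eq_empty_or_singleton
  · exact h.isOddCycleBouquet (c := x) fun y _ => hH y (Set.notMem_empty y)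
  · exact h.isOddCycleBouquet hH

theorem isDoublyExtendedBouquetDipole (h : UnivIsOnlySkewFort G) (hH : IsBranchCover G H)
    (hdeg : ∀ u ∈ H, (G.neighborSet u).ncard ≠ 2) [Nontrivial (LinkClass G H)] :
    IsDoublyExtendedBouquetDipole G := by
  obtain ⟨E⟩ := h.nonempty_thinEdges hH fun u hu =>
    nontrivial_sdiff_singleton (h.nontrivial_neighborSet u) (hdeg u hu)
  have : Nonempty H := E.cls.nonempty
  obtain ⟨m, s, hs⟩ := E.exists_isDipoleLayout (E.isOddlyThreaded h hH)
  exact hs.isDoublyExtendedBouquetDipole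

theorem isDoublyExtendedBouquetDipole_or_isOddCycleBouquet (h : UnivIsOnlySkewFort G) :
    IsDoublyExtendedBouquetDipole G ∨ IsOddCycleBouquet G := by
  have hH : IsBranchCover G {x | (G.neighborSet x).ncard ≠ 2} := fun _ => not_not.1
  rcases subsingleton_or_nontrivial (LinkClass G {x | (G.neighborSet x).ncard ≠ 2}) with _ | _
  · exact Or.inr (h.isOddCycleBouquet_of_subsingleton hH)
  · exact Or.inl (h.isDoublyExtendedBouquetDipole hH fun _ => id)

end UnivIsOnlySkewFort

theorem HasUniformSkewForts.eq_bot [Fintype V] {f : ℕ} (h : HasUniformSkewForts G f)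
    (hf : f ≤ 1) : G = ⊥ := by
  classical
  have hf0 : f ≠ 0 := by
    rintro rfl
    simpa using (h.isSkewFort ∅ Finset.card_empty).1
  ext x w
  refine iff_of_false (fun hxw => ?_) id
  have := h.le_degree_add hf0 hxw
  have := G.degree_lt_card_verts x
  omega

end Classification

theorem mainTheorem4 {V : Type*} [Fintype V] [DecidableEq V] (G : SimpleGraph V) :
    skewZeroForcingSpan G = 0 ↔
      G = ⊤ ∨ G = ⊥ ∨ IsDoublyExtendedBouquetDipole G ∨ IsOddCycleBouquet G ∨
        IsTwoSetPerfectlyOrderable G := by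
  constructor
  · intro h
    obtain hno | ⟨f, hf⟩ := skewZeroForcingSpan_eq_zero_iff.1 h
    · exact Or.inr <| Or.inr <| Or.inr <| Or.inr <| forall_not_isSkewFort_iff.1 hno
    obtain hf1 | hf2 : f ≤ 1 ∨ 2 ≤ f := by omega
    · exact Or.inr <| Or.inl <| hf.eq_bot hf1
    obtain hfn | rfl := hf.le_card.lt_or_eq
    · exact Or.inl <| hf.eq_top hf2 hfn
    have : Nontrivial V := Fintype.one_lt_card_iff_nontrivial.1 hf2
    obtain hdipole | hbouquet :=
      hf.univIsOnlySkewFort.isDoublyExtendedBouquetDipole_or_isOddCycleBouquet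
    · exact Or.inr <| Or.inr <| Or.inl hdipole
    · exact Or.inr <| Or.inr <| Or.inr <| Or.inl hbouquet
  · rintro (rfl | rfl | h | h | h)
    · exact skewZeroForcingSpan_top
    · exact skewZeroForcingSpan_bot
    · exact h.univIsOnlySkewFort.skewZeroForcingSpan_eq_zero
    · exact h.univIsOnlySkewFort.skewZeroForcingSpan_eq_zero
    · exact skewZeroForcingSpan_eq_zero_of_forall_not_isSkewFort (forall_not_isSkewFort_iff.2 h)
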